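/- \textbf{Setting.} Let $q_0$ be a probability distribution on $\mathbb{R}^d$, $d \ge 1$, with finite second moment $\mathbb{E}_{y\sim q_0}\|y\|^2 = m_2^2$, $m_2 \ge 0$. For $t>0$ put $\sigma_t = \sqrt{1-e^{-2t}}$, let $q_t$ be the law of $x = e^{-t}y + z$ with $y\sim q_0$ and $z\sim\mathcal N(0,\sigma_t^2 I_d)$ independent, and let $s_t = \nabla \log q_t$ be its score (the gradient of the logarithm of its Lebesgue density). For functions $f,g:\mathbb{R}^d\to\mathbb{R}^d$, a distribution $p$ and $\delta \in (0,1)$, write $D_p^{\delta}(f,g)\le r$ if $\Pr_{x\sim p}[\|f(x)-g(x)\|\le r]\ge 1-\delta$. Fix a fully connected architecture with ReLU activations from $\mathbb{R}^d$ to $\mathbb{R}^d$ with $D\ge 1$ layers (weight matrices) and arbitrary positive hidden widths, either without biases, $\phi_\theta(x) = M_D\,\mathrm{ReLU}(M_{D-1}\cdots\mathrm{ReLU}(M_1x))$, or with a bias vector in every layer. Let $\theta\in\mathbb{R}^P$ collect all $P$ parameters (the entries of all weight matrices and, if present, of all biases), and let $\|\theta\|_F$ be the square root of the sum of their squares. Given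 i.i.d. samples $y_1,\dots,y_m\sim q_0$, draw independent $z_1,\dots,z_m\sim\mathcal N(0,\sigma_t^2I_d)$, put $x_i = e^{-t}y_i+z_i$, and call $\widehat\theta$ an empirical minimizer if it minimizes the score matching objective \[ \frac1m\sum_{i=1}^m \Big\|\phi_\theta(x_i)-\frac{-z_i}{\sigma_t^2}\Big\|^2 \] over all $\theta$ with $\|\theta\|_F\le\Theta$. \textbf{Lemma.} There are universal constants $C,K>0$ and $k\in\mathbb{N}$ such that the following holds for all $d$, $q_0$, $m_2$, $t$ and all architectures as above, all $\Theta>1$, all $\varepsilon\in(0,1]$ and all $\delta_{\text{score}},\delta_{\mathcal D}\in(0,1)$. Suppose there is a $\theta^*$ with $\|\theta^*\|_F\le\Theta$ and \[ \mathbb{E}_{x\sim q_t}\left[\|\phi_{\theta^*}(x)-s_t(x)\|^2\right]\le\frac{\delta_{\text{score}}\cdot\delta_{\mathcal D}\cdot\varepsilon^2}{C\cdot\sigma_t^2}. \] Let \[ X = \frac{(d+\log\frac1{\delta_{\mathcal D}})\cdot PD}{\varepsilon^2\,\delta_{\text{score}}}\cdot\left(1+\log\frac{\max(m_2,1)\cdot\Theta}{\delta_{\mathcal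 D}}\right). \] If $m > K\, X\, \log^k(2+X)$ (that is, $m>\widetilde O(X)$), then, with probability at least $1-\delta_{\mathcal D}$ over the $y_i$ and $z_i$, every empirical minimizer $\widehat\theta$ satisfies \[ D_{q_t}^{\delta_{\text{score}}}(\phi_{\widehat\theta},s_t)\le\varepsilon/\sigma_t . \] -/

import Mathlib

open MeasureTheory ProbabilityTheory

noncomputable section

namespace ScoreLearning

/-! ### Fully connected ReLU networks

An architecture is an input dimension `n`, a list `hs` of hidden widths, and an output
dimension `o`; it has `hs.length + 1` weight matrices. The flag `biased` says whether every
layer also carries a bias vector. -/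

/-- Index set of the entries of one layer `ℝⁿ → ℝᵒ`: the entry `(i, inl j)` is the `(i, j)` entry
of the weight matrix, and, if the layer has a bias, `(i, inr 0)` is the `i`-th bias. -/
abbrev LayerIndex (biased : Bool) (n o : ℕ) : Type :=
  Fin o × (Fin n ⊕ Fin biased.toNat)

/-- Index set of all the parameters of a network. -/
def ParamIndex (biased : Bool) : ℕ → List ℕ → ℕ → Type
  | n, [], o => LayerIndex biased n o
  | n, h :: hs, o => LayerIndex biased n h ⊕ ParamIndex biased h hs o

instance instFintypeParamIndex (biased : Bool) :
    (n : ℕ) → (hs : List ℕ) → (o : ℕ) → Fintype (ParamIndex biased n hs o)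
  | n, [], o => inferInstanceAs (Fintype (LayerIndex biased n o))
  | n, h :: hs, o =>
    letI := instFintypeParamIndex biased h hs o
    inferInstanceAs (Fintype (LayerIndex biased n h ⊕ ParamIndex biased h hs o))

/-- The weight vector `θ` of a network. Its Euclidean norm `‖θ‖` is the Frobenius norm: the square
root of the sum of the squares of all the entries of all the layers. -/
abbrev Params (biased : Bool) (n : ℕ) (hs : List ℕ) (o : ℕ) : Type :=
  EuclideanSpace ℝ (ParamIndex biased n hs o)

/-- The total number `P` of parameters. -/
def numParams (biased : Bool) (n : ℕ) (hs : List ℕ) (o : ℕ) : ℕ :=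
  Fintype.card (ParamIndex biased n hs o)

/-- The depth: the number of layers (weight matrices). -/
def depth (hs : List ℕ) : ℕ := hs.length + 1

/-- The affine map (linear if `biased = false`) of one layer. -/
def layerMap {biased : Bool} {n o : ℕ} (W : LayerIndex biased n o → ℝ)
    (x : EuclideanSpace ℝ (Fin n)) : EuclideanSpace ℝ (Fin o) :=
  WithLp.toLp 2 fun i =>
    ∑ j : Fin n, W (i, Sum.inl j) * x j + ∑ k : Fin biased.toNat, W (i, Sum.inr k)

/-- Coordinatewise ReLU. -/
def relu {n : ℕ} (x : EuclideanSpace ℝ (Fin n)) : EuclideanSpace ℝ (Fin n) :=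
  WithLp.toLp 2 fun i => max (x i) 0

/-- Evaluation of the network, with ReLU after every layer except the last. -/
def evalNet {biased : Bool} : {n : ℕ} → {hs : List ℕ} → {o : ℕ} →
    (ParamIndex biased n hs o → ℝ) → EuclideanSpace ℝ (Fin n) → EuclideanSpace ℝ (Fin o)
  | _, [], _, θ, x => layerMap θ x
  | _, _ :: _, _, θ, x =>
    evalNet (fun k => θ (Sum.inr k)) (relu (layerMap (fun k => θ (Sum.inl k)) x))

/-- The function `φ_θ` computed by the network with weight vector `θ`. -/
def net {biased : Bool} {n : ℕ} {hs : List ℕ} {o : ℕ} (θ : Params biased n hs o) :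
    EuclideanSpace ℝ (Fin n) → EuclideanSpace ℝ (Fin o) :=
  evalNet (fun k => θ k)

theorem numParams_nil (biased : Bool) (n o : ℕ) :
    numParams biased n [] o = o * (n + biased.toNat) := by
  have h : numParams biased n [] o = Fintype.card (LayerIndex biased n o) := rfl
  rw [h]
  simp [LayerIndex]

theorem numParams_cons (biased : Bool) (n h : ℕ) (hs : List ℕ) (o : ℕ) :
    numParams biased n (h :: hs) o = h * (n + biased.toNat) + numParams biased h hs o := by
  have h' : numParams biased n (h :: hs) o
      = Fintype.card (LayerIndex biased n h ⊕ ParamIndex biased h hs o) := rfl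
  rw [h', Fintype.card_sum]
  simp [LayerIndex, numParams]

/-! ### The smoothed distribution and its score -/

/-- `σ_t = √(1 - e^{-2t})`. -/
def noiseLevel (t : ℝ) : ℝ := Real.sqrt (1 - Real.exp (-2 * t))

/-- The Gaussian distribution `N(0, σ_t² I_d)`. -/
def noise (d : ℕ) (t : ℝ) : Measure (EuclideanSpace ℝ (Fin d)) :=
  (stdGaussian (EuclideanSpace ℝ (Fin d))).map fun g => noiseLevel t • g

/-- The noised point `x = e^{-t} y + z` made from the pair `(y, z)`. -/
def noised {d : ℕ} (t : ℝ) (p : EuclideanSpace ℝ (Fin d) × EuclideanSpace ℝ (Fin d)) :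
    EuclideanSpace ℝ (Fin d) :=
  Real.exp (-t) • p.1 + p.2

/-- The joint law of `(y, z)` with `y ∼ q₀` and `z ∼ N(0, σ_t² I_d)` independent. -/
def sampleLaw {d : ℕ} (q₀ : Measure (EuclideanSpace ℝ (Fin d))) (t : ℝ) :
    Measure (EuclideanSpace ℝ (Fin d) × EuclideanSpace ℝ (Fin d)) :=
  q₀.prod (noise d t)

/-- The distribution `q_t` of `x = e^{-t} y + z`. -/
def smoothed {d : ℕ} (q₀ : Measure (EuclideanSpace ℝ (Fin d))) (t : ℝ) :
    Measure (EuclideanSpace ℝ (Fin d)) :=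
  (sampleLaw q₀ t).map (noised t)

/-- The (smooth, positive) Lebesgue density of `q_t`. -/
def smoothedDensity {d : ℕ} (q₀ : Measure (EuclideanSpace ℝ (Fin d))) (t : ℝ)
    (x : EuclideanSpace ℝ (Fin d)) : ℝ :=
  ∫ y, (Real.sqrt (2 * Real.pi * noiseLevel t ^ 2) ^ d)⁻¹ *
    Real.exp (-‖x - Real.exp (-t) • y‖ ^ 2 / (2 * noiseLevel t ^ 2)) ∂q₀

/-- The score `s_t = ∇ log q_t`. -/
def score {d : ℕ} (q₀ : Measure (EuclideanSpace ℝ (Fin d))) (t : ℝ) :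
    EuclideanSpace ℝ (Fin d) → EuclideanSpace ℝ (Fin d) :=
  gradient fun x => Real.log (smoothedDensity q₀ t x)

/-! ### Quantile error and empirical score matching -/

/-- `D_p^δ(f, g) ≤ r`, which means `Pr_{x ∼ p}[‖f x - g x‖ ≤ r] ≥ 1 - δ`. -/
def QuantileErrorLE {d : ℕ} (p : Measure (EuclideanSpace ℝ (Fin d))) (δ : ℝ)
    (f g : EuclideanSpace ℝ (Fin d) → EuclideanSpace ℝ (Fin d)) (r : ℝ) : Prop :=
  ENNReal.ofReal (1 - δ) ≤ p {x | ‖f x - g x‖ ≤ r}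

/-- The score matching objective `(1/m) ∑ᵢ ‖f(xᵢ) - (-zᵢ/σ_t²)‖²`, where `ω i = (yᵢ, zᵢ)` and
`xᵢ = e^{-t} yᵢ + zᵢ`. -/
def empiricalLoss {d m : ℕ} (t : ℝ)
    (ω : Fin m → EuclideanSpace ℝ (Fin d) × EuclideanSpace ℝ (Fin d))
    (f : EuclideanSpace ℝ (Fin d) → EuclideanSpace ℝ (Fin d)) : ℝ :=
  (1 / (m : ℝ)) * ∑ i, ‖f (noised t (ω i)) - (-(1 / noiseLevel t ^ 2)) • (ω i).2‖ ^ 2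

/-- `θ` minimizes the score matching objective over the ball `‖θ‖_F ≤ Θ`. -/
def IsEmpiricalMinimizer {biased : Bool} {d m : ℕ} {hs : List ℕ} (t Θ : ℝ)
    (ω : Fin m → EuclideanSpace ℝ (Fin d) × EuclideanSpace ℝ (Fin d))
    (θ : Params biased d hs d) : Prop :=
  ‖θ‖ ≤ Θ ∧ ∀ θ' : Params biased d hs d, ‖θ'‖ ≤ Θ →
    empiricalLoss t ω (net θ) ≤ empiricalLoss t ω (net θ')

/-- The expression inside the `Õ` of the sample complexity bound. -/
def sampleBound (d P D : ℕ) (m₂ Θ ε δscore δtrain : ℝ) : ℝ :=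
  ((d + Real.log (1 / δtrain)) * P * D) / (ε ^ 2 * δscore) *
    (1 + Real.log (max m₂ 1 * Θ / δtrain))

end ScoreLearning

end

/-!
Write `Y = -z / σ²` for the regression target and `ξ = Y - s(x)` for the regression noise. By
Tweedie's formula (`score_eq_integral_posterior`) the score is the posterior mean of `Y` given `x`,
so `ξ` has conditional mean zero, and the excess loss of a function `f` on a sample is
`‖f - s‖² - 2 ⟪f - s, ξ⟫` (`excessLoss_eq`).

The noise `ξ` is not uniformly sub-Gaussian given `x`, but the posterior Gaussian moment
`E[exp(‖z‖² / (4 σ²)) | x]` has mean at most `2 ^ d`, hence it is at most `B = 15 m 2 ^ d / δ` at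
all `m` samples except with probability `δ / 15`. Restricting to the set of those `x` does not
disturb the conditional mean, and on it `ξ` is sub-Gaussian with variance proxy of order
`log B / σ²` (`integral_exp_inner_sub_mean_le`). Since the cross term is then controlled by
`‖f - s‖²` itself, the exponential moment `E exp(-a (‖f - s‖² - 2 ⟪f - s, ξ⟫))` with
`a = σ² / (128 log B)` is at most `E exp(-a ‖f - s‖² / 2)`. This yields two Chernoff bounds: a
fixed `f` with `P(‖f - s‖ > ε / (2σ)) ≥ δ_score / 2` has total excess loss above
`T = m δ_score ε² / (64 σ²)` except with probability `exp(-m δ_score ε² / (8192 log B))`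
(`measure_sum_excessLoss_le_le`), and the excess loss of `φ_{θ*}` is at most `3/2` of its squared
error plus `log(5 / δ) / a` (`measure_sum_excessLoss_ge_le`), which Markov's inequality puts below
`T / 2`.

The first bound is applied to a grid in the ball of weights. A network is Lipschitz in its weights
with constant `(3Θ) ^ D (‖x‖ + 1)` (`norm_net_sub_le`), so on bounded samples the total loss of an
empirical minimizer differs from that of the nearest grid point by at most `T / 2`. A minimizer with
large quantile error would thus have excess loss both above `T / 2` and at most `T / 2`
(`measure_bad_minimizer_le`). The logarithm of the grid size is of order
`P D (1 + log(max(m₂, 1) Θ / δ)) log m`, and `log B` is of order `(d + log(1 / δ)) log m`, which is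
where the sample complexity comes from (`numerical_requirements`).
-/

noncomputable section

namespace ScoreLearning

/-! ### Lipschitz dependence of a network on its weights -/

theorem layerMap_sub_left {biased : Bool} {n o : ℕ} (W W' : LayerIndex biased n o → ℝ)
    (x : EuclideanSpace ℝ (Fin n)) :
    layerMap W x - layerMap W' x = layerMap (fun k => W k - W' k) x := by
  ext i
  simp only [layerMap, PiLp.sub_apply, sub_mul, Finset.sum_sub_distrib]
  ring

theorem norm_layerMap_le {biased : Bool} {n o : ℕ} (W : LayerIndex biased n o → ℝ) {R : ℝ}
    (hR : 0 ≤ R) (hW : ∑ k, W k ^ 2 ≤ R ^ 2) (x : EuclideanSpace ℝ (Fin n)) :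
    ‖layerMap W x‖ ≤ R * (‖x‖ + 1) := by
  refine le_of_sq_le_sq ?_ (by positivity)
  -- the input, extended by a constant coordinate if there is a bias
  let v : Fin n ⊕ Fin biased.toNat → ℝ := Sum.elim (fun j => x j) (fun _ => 1)
  have hv : ∑ c, v c ^ 2 ≤ (‖x‖ + 1) ^ 2 := by
    have hb : (biased.toNat : ℝ) ≤ 1 := by exact_mod_cast Bool.toNat_le biased
    simp only [v, Fintype.sum_sum_type, Sum.elim_inl, Sum.elim_inr, one_pow, Finset.sum_const,
      Finset.card_univ, Fintype.card_fin, nsmul_eq_mul, mul_one]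
    rw [← EuclideanSpace.real_norm_sq_eq]
    nlinarith [norm_nonneg x]
  have h1 : ∀ i, (layerMap W x) i = ∑ c, W (i, c) * v c := by
    intro i
    simp [layerMap, v, Fintype.sum_sum_type]
  rw [EuclideanSpace.real_norm_sq_eq]
  calc ∑ i, (layerMap W x) i ^ 2
      ≤ ∑ i, (∑ c, W (i, c) ^ 2) * (∑ c, v c ^ 2) := by
        refine Finset.sum_le_sum fun i _ => ?_
        rw [h1]
        exact Finset.sum_mul_sq_le_sq_mul_sq _ _ _
    _ = (∑ k, W k ^ 2) * (∑ c, v c ^ 2) := by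
        rw [← Finset.sum_mul, Fintype.sum_prod_type]
    _ ≤ R ^ 2 * (‖x‖ + 1) ^ 2 := by gcongr
    _ = (R * (‖x‖ + 1)) ^ 2 := by ring

theorem norm_layerMap_sub_right_le {biased : Bool} {n o : ℕ} (W : LayerIndex biased n o → ℝ)
    {R : ℝ} (hR : 0 ≤ R) (hW : ∑ k, W k ^ 2 ≤ R ^ 2) (x x' : EuclideanSpace ℝ (Fin n)) :
    ‖layerMap W x - layerMap W x'‖ ≤ R * ‖x - x'‖ := by
  refine le_of_sq_le_sq ?_ (by positivity)
  have h1 : ∀ i, (layerMap W x - layerMap W x') i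
      = ∑ j, W (i, Sum.inl j) * (x - x') j := by
    intro i
    simp only [layerMap, PiLp.sub_apply, mul_sub, Finset.sum_sub_distrib]
    ring
  rw [EuclideanSpace.real_norm_sq_eq]
  calc ∑ i, (layerMap W x - layerMap W x') i ^ 2
      ≤ ∑ i, (∑ c, W (i, c) ^ 2) * ‖x - x'‖ ^ 2 := by
        refine Finset.sum_le_sum fun i _ => ?_
        rw [h1]
        refine (Finset.sum_mul_sq_le_sq_mul_sq _ _ _).trans ?_
        rw [← EuclideanSpace.real_norm_sq_eq]
        gcongr
        rw [Fintype.sum_sum_type]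
        exact le_add_of_nonneg_right (Finset.sum_nonneg fun _ _ => sq_nonneg _)
    _ = (∑ k, W k ^ 2) * ‖x - x'‖ ^ 2 := by
        rw [← Finset.sum_mul, Fintype.sum_prod_type]
    _ ≤ R ^ 2 * ‖x - x'‖ ^ 2 := by gcongr
    _ = (R * ‖x - x'‖) ^ 2 := by ring

theorem norm_relu_sub_le {n : ℕ} (x x' : EuclideanSpace ℝ (Fin n)) :
    ‖relu x - relu x'‖ ≤ ‖x - x'‖ := by
  refine le_of_sq_le_sq ?_ (norm_nonneg _)
  rw [EuclideanSpace.real_norm_sq_eq, EuclideanSpace.real_norm_sq_eq]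
  refine Finset.sum_le_sum fun i _ => ?_
  rw [sq_le_sq]
  simpa [relu] using abs_max_sub_max_le_abs (x i) (x' i) 0

theorem norm_relu_le {n : ℕ} (x : EuclideanSpace ℝ (Fin n)) : ‖relu x‖ ≤ ‖x‖ := by
  have h0 : relu (0 : EuclideanSpace ℝ (Fin n)) = 0 := by ext i; simp [relu]
  simpa [h0] using norm_relu_sub_le x 0

theorem sum_paramIndex_cons {biased : Bool} {n h o : ℕ} {hs : List ℕ}
    (f : ParamIndex biased n (h :: hs) o → ℝ) :
    ∑ k, f k = ∑ k : LayerIndex biased n h, f (Sum.inl k)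
      + ∑ k : ParamIndex biased h hs o, f (Sum.inr k) :=
  Fintype.sum_sum_type (α₁ := LayerIndex biased n h) (α₂ := ParamIndex biased h hs o) f

/-- One layer at a time, a perturbation of the weights by `η` and of the input by `‖x - x'‖` is
amplified by a factor at most `3R`. -/
theorem norm_evalNet_sub_le {biased : Bool} {R η : ℝ} (hR : 1 ≤ R) (hη : 0 ≤ η) :
    ∀ {n : ℕ} {hs : List ℕ} {o : ℕ} (θ θ' : ParamIndex biased n hs o → ℝ),
      ∑ k, θ k ^ 2 ≤ R ^ 2 → ∑ k, θ' k ^ 2 ≤ R ^ 2 → ∑ k, (θ k - θ' k) ^ 2 ≤ η ^ 2 →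
      ∀ x x' : EuclideanSpace ℝ (Fin n),
        ‖evalNet θ x - evalNet θ' x'‖ ≤ (3 * R) ^ depth hs * (η * (‖x‖ + 1) + ‖x - x'‖) := by
  have layer : ∀ {n o : ℕ} (W W' : LayerIndex biased n o → ℝ),
      ∑ k, W' k ^ 2 ≤ R ^ 2 → ∑ k, (W k - W' k) ^ 2 ≤ η ^ 2 →
      ∀ x x' : EuclideanSpace ℝ (Fin n),
        ‖layerMap W x - layerMap W' x'‖ ≤ η * (‖x‖ + 1) + R * ‖x - x'‖ := by
    intro n o W W' hW' hd x x'
    calc ‖layerMap W x - layerMap W' x'‖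
        = ‖(layerMap W x - layerMap W' x) + (layerMap W' x - layerMap W' x')‖ := by
          congr 1; abel
      _ ≤ _ := norm_add_le _ _
      _ ≤ _ := by
          rw [layerMap_sub_left]
          exact add_le_add (norm_layerMap_le _ hη hd x)
            (norm_layerMap_sub_right_le _ (by linarith) hW' x x')
  intro n hs
  induction hs generalizing n with
  | nil =>
    intro o θ θ' _ hθ' hd x x'
    refine (layer (o := o) θ θ' hθ' hd x x').trans ?_
    have : 0 ≤ η * (‖x‖ + 1) := by positivity
    simp only [depth, List.length_nil, zero_add, pow_one]
    nlinarith [norm_nonneg (x - x')]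
  | cons h hs ih =>
    intro o θ θ' hθ hθ' hd x x'
    rw [sum_paramIndex_cons] at hθ hθ' hd
    have hnn : ∀ {ι : Type} [Fintype ι] (f : ι → ℝ), 0 ≤ ∑ k, f k ^ 2 :=
      fun f => Finset.sum_nonneg fun _ _ => sq_nonneg _
    have e1 := hnn fun k : LayerIndex biased n h => θ (Sum.inl k)
    have e2 := hnn fun k : ParamIndex biased h hs o => θ (Sum.inr k)
    have e3 := hnn fun k : LayerIndex biased n h => θ' (Sum.inl k)
    have e4 := hnn fun k : ParamIndex biased h hs o => θ' (Sum.inr k)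
    have e5 := hnn fun k : LayerIndex biased n h => θ (Sum.inl k) - θ' (Sum.inl k)
    have e6 := hnn fun k : ParamIndex biased h hs o => θ (Sum.inr k) - θ' (Sum.inr k)
    set W : LayerIndex biased n h → ℝ := fun k => θ (Sum.inl k)
    set W' : LayerIndex biased n h → ℝ := fun k => θ' (Sum.inl k)
    have h1 : ‖relu (layerMap W x) - relu (layerMap W' x')‖
        ≤ η * (‖x‖ + 1) + R * ‖x - x'‖ :=
      (norm_relu_sub_le _ _).trans (layer W W' (by linarith) (by linarith) x x')
    have h2 : ‖relu (layerMap W x)‖ ≤ R * (‖x‖ + 1) :=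
      (norm_relu_le _).trans (norm_layerMap_le W (by linarith) (by linarith) x)
    have h3 := ih (fun k => θ (Sum.inr k)) (fun k => θ' (Sum.inr k)) (by linarith) (by linarith)
      (by linarith) (relu (layerMap W x)) (relu (layerMap W' x'))
    refine h3.trans ?_
    have hdep : depth (h :: hs) = depth hs + 1 := rfl
    rw [hdep, pow_succ, mul_assoc]
    have hx := norm_nonneg x
    have hxx := norm_nonneg (x - x')
    have h4 : η * (‖relu (layerMap W x)‖ + 1) ≤ η * (R * (‖x‖ + 1) + 1) := by gcongr
    have h5 : η * (‖x‖ + 1) ≤ η * (‖x‖ + 1) * R := le_mul_of_one_le_right (by positivity) hR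
    have h6 : η ≤ η * (‖x‖ + 1) * R := by
      refine le_trans ?_ h5
      nlinarith
    gcongr
    nlinarith [mul_nonneg (by linarith : 0 ≤ R) hxx]

theorem sum_sq_le_of_norm_le {ι : Type*} [Fintype ι] (θ : EuclideanSpace ℝ ι) {R : ℝ}
    (h : ‖θ‖ ≤ R) : ∑ k, θ k ^ 2 ≤ R ^ 2 := by
  rw [← EuclideanSpace.real_norm_sq_eq]
  gcongr

theorem norm_net_sub_le {biased : Bool} {n : ℕ} {hs : List ℕ} {o : ℕ} {R η : ℝ} (hR : 1 ≤ R)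
    {θ θ' : Params biased n hs o} (hθ : ‖θ‖ ≤ R) (hθ' : ‖θ'‖ ≤ R) (hd : ‖θ - θ'‖ ≤ η)
    (x : EuclideanSpace ℝ (Fin n)) :
    ‖net θ x - net θ' x‖ ≤ (3 * R) ^ depth hs * (η * (‖x‖ + 1)) := by
  have hη : 0 ≤ η := (norm_nonneg _).trans hd
  simpa [net] using norm_evalNet_sub_le hR hη (fun k => θ k) (fun k => θ' k)
    (sum_sq_le_of_norm_le θ hθ) (sum_sq_le_of_norm_le θ' hθ')
    (by simpa using sum_sq_le_of_norm_le _ hd) x x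

theorem norm_net_le {biased : Bool} {n : ℕ} {hs : List ℕ} {o : ℕ} {R : ℝ} (hR : 1 ≤ R)
    {θ : Params biased n hs o} (hθ : ‖θ‖ ≤ R) (x : EuclideanSpace ℝ (Fin n)) :
    ‖net θ x‖ ≤ (3 * R) ^ depth hs * (R * (‖x‖ + 1)) := by
  have hzero : ∀ {n : ℕ} (hs : List ℕ) {o : ℕ} (x : EuclideanSpace ℝ (Fin n)),
      evalNet (fun _ : ParamIndex biased n hs o => (0 : ℝ)) x = 0 := by
    intro n hs
    induction hs generalizing n with
    | nil => intro o x; ext i; simp [evalNet, layerMap]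
    | cons h hs ih => intro o x; simpa [evalNet] using ih _
  have h0 : net (0 : Params biased n hs o) x = 0 := hzero hs x
  simpa [h0] using norm_net_sub_le hR hθ (θ' := 0) (by simpa using by linarith)
    (by simpa using hθ) x

theorem continuous_net {biased : Bool} {n : ℕ} {hs : List ℕ} {o : ℕ} (θ : Params biased n hs o) :
    Continuous (net θ) := by
  have key := fun x x' => norm_evalNet_sub_le (R := ‖θ‖ + 1) (by linarith [norm_nonneg θ]) le_rfl
    (fun k => θ k) (fun k => θ k) (sum_sq_le_of_norm_le θ (by linarith))
    (sum_sq_le_of_norm_le θ (by linarith)) (by simp) x x'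
  refine (LipschitzWith.of_dist_le' (K := (3 * (‖θ‖ + 1)) ^ depth hs) fun x x' => ?_).continuous
  simpa [dist_eq_norm, net] using key x x'

theorem le_numParams {biased : Bool} {n : ℕ} {hs : List ℕ} {o : ℕ} (hn : 0 < n)
    (hhs : ∀ h ∈ hs, 0 < h) : o ≤ numParams biased n hs o := by
  induction hs generalizing n with
  | nil => rw [numParams_nil]; exact Nat.le_mul_of_pos_right _ (by omega)
  | cons h hs ih =>
    rw [numParams_cons]
    exact (ih (hhs h (by simp)) fun k hk => hhs k (by simp [hk])).trans (Nat.le_add_left _ _)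

/-! ### A grid in a ball of weights -/

/-- Rounding every coordinate towards zero to a multiple of `η / P` moves a point by at most `η`
and does not increase its norm. -/
theorem exists_finset_net {ι : Type*} [Fintype ι] {R η : ℝ} (hR : 0 ≤ R) (hη : 0 < η) (hηR : η ≤ R)
    (hι : 0 < Fintype.card ι) :
    ∃ N : Finset (EuclideanSpace ℝ ι),
      (N.card : ℝ) ≤ (3 * R * Fintype.card ι / η) ^ Fintype.card ι ∧
      ∀ θ : EuclideanSpace ℝ ι, ‖θ‖ ≤ R → ∃ θ' ∈ N, ‖θ'‖ ≤ R ∧ ‖θ - θ'‖ ≤ η := by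
  classical
  have hP : (1 : ℝ) ≤ Fintype.card ι := by exact_mod_cast hι
  set P := Fintype.card ι with hPdef
  set h : ℝ := η / P with hh
  have hpos : 0 < h := by positivity
  set k : ℤ := ⌊R / h⌋ with hk
  have hk0 : 0 ≤ k := Int.floor_nonneg.2 (by positivity)
  -- integer coordinates of the grid points, before scaling by `h`
  let S : Finset (ι → ℤ) := Fintype.piFinset fun _ => Finset.Icc (-k) k
  let F : (ι → ℤ) → EuclideanSpace ℝ ι := fun u => WithLp.toLp 2 fun i => (u i : ℝ) * h
  refine ⟨S.image F, ?_, ?_⟩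
  · have hS : (S.card : ℝ) = (2 * k + 1 : ℝ) ^ P := by
      have : S.card = (2 * k + 1).toNat ^ P := by
        simp only [S, Fintype.card_piFinset, Int.card_Icc, Finset.prod_const, Finset.card_univ]
        rw [hPdef]
        congr 2
        ring
      have h3 : ((2 * k + 1).toNat : ℤ) = 2 * k + 1 := Int.toNat_of_nonneg (by omega)
      rw [this, Nat.cast_pow]
      congr 1
      exact_mod_cast h3
    calc ((S.image F).card : ℝ) ≤ S.card := by exact_mod_cast Finset.card_image_le
      _ = _ := hS
      _ ≤ _ := by
        have hk0' : (0 : ℝ) ≤ k := by exact_mod_cast hk0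
        gcongr
        have h1 : (k : ℝ) ≤ R / h := Int.floor_le _
        have h2 : R / h = R * P / η := by rw [hh]; field_simp
        have h3 : 1 ≤ R * P / η := by
          rw [le_div_iff₀ hη]; nlinarith
        have h4 : 3 * R * P / η = 3 * (R * P / η) := by ring
        rw [h4]; linarith
  · intro θ hθ
    -- rounding a real number towards zero
    have round : ∀ a : ℝ, |a| ≤ R →
        ∃ u : ℤ, u ∈ Finset.Icc (-k) k ∧ |(u : ℝ) * h| ≤ |a| ∧ |a - u * h| ≤ h := by
      intro a ha
      have main : ∀ b : ℝ, 0 ≤ b → b ≤ R →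
          0 ≤ ⌊b / h⌋ ∧ ⌊b / h⌋ ≤ k ∧ (⌊b / h⌋ : ℝ) * h ≤ b ∧ b - ⌊b / h⌋ * h ≤ h := by
        intro b hb hbR
        refine ⟨Int.floor_nonneg.2 (by positivity), Int.floor_le_floor (by gcongr), ?_, ?_⟩
        · exact (le_div_iff₀ hpos).1 (Int.floor_le _)
        · have := (div_lt_iff₀ hpos).1 (Int.lt_floor_add_one (b / h))
          linarith
      obtain ⟨h1, h2, h3, h4⟩ := main |a| (abs_nonneg a) ha
      have h1' : (0 : ℝ) ≤ (⌊|a| / h⌋ : ℝ) * h := mul_nonneg (by exact_mod_cast h1) hpos.le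
      rcases le_total 0 a with h0 | h0
      · refine ⟨⌊|a| / h⌋, Finset.mem_Icc.2 ⟨by omega, h2⟩, ?_, ?_⟩
        · rwa [abs_of_nonneg h1']
        · rw [abs_of_nonneg h0] at *
          rw [abs_of_nonneg (by linarith)]; exact h4
      · refine ⟨-⌊|a| / h⌋, Finset.mem_Icc.2 ⟨by omega, by omega⟩, ?_, ?_⟩
        · push_cast
          rw [neg_mul, abs_neg]
          rwa [abs_of_nonneg h1']
        · push_cast
          have h5 : a - -(⌊|a| / h⌋ : ℝ) * h = -(|a| - ⌊|a| / h⌋ * h) := by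
            rw [abs_of_nonpos h0]; ring
          rw [h5, abs_neg, abs_of_nonneg (by linarith)]; exact h4
    have hcoord : ∀ i, |θ i| ≤ R := fun i => by
      simpa using (PiLp.norm_apply_le θ i).trans hθ
    choose u hu1 hu2 hu3 using fun i => round (θ i) (hcoord i)
    refine ⟨F u, Finset.mem_image_of_mem _ (Fintype.mem_piFinset.2 hu1), ?_, ?_⟩
    · refine le_trans (le_of_sq_le_sq ?_ (norm_nonneg _)) hθ
      rw [EuclideanSpace.real_norm_sq_eq, EuclideanSpace.real_norm_sq_eq]
      exact Finset.sum_le_sum fun i _ => sq_le_sq.2 (hu2 i)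
    · refine le_of_sq_le_sq ?_ hη.le
      rw [EuclideanSpace.real_norm_sq_eq]
      calc ∑ i, (θ - F u) i ^ 2 ≤ ∑ _i : ι, h ^ 2 :=
            Finset.sum_le_sum fun i _ => by
              rw [sq_le_sq, abs_of_pos hpos]; exact hu3 i
        _ = P * h ^ 2 := by simp [hPdef]
        _ ≤ P * (P * h ^ 2) := by
            gcongr; exact le_mul_of_one_le_left (by positivity) hP
        _ = η ^ 2 := by rw [hh]; field_simp

section

/-! ### The density of the noise -/

/-- The Lebesgue density of `N(0, s² I_d)`. -/
def gaussianKernel {d : ℕ} (s : ℝ) (v : EuclideanSpace ℝ (Fin d)) : ℝ :=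
  (Real.sqrt (2 * Real.pi * s ^ 2) ^ d)⁻¹ * Real.exp (-‖v‖ ^ 2 / (2 * s ^ 2))

variable {d : ℕ} {s t : ℝ}

theorem gaussianKernel_pos (hs : 0 < s) (v : EuclideanSpace ℝ (Fin d)) :
    0 < gaussianKernel s v := by
  unfold gaussianKernel; positivity

theorem continuous_gaussianKernel :
    Continuous (gaussianKernel s : EuclideanSpace ℝ (Fin d) → ℝ) := by
  unfold gaussianKernel; fun_prop

theorem gaussianKernel_le (v : EuclideanSpace ℝ (Fin d)) :
    gaussianKernel s v ≤ (Real.sqrt (2 * Real.pi * s ^ 2) ^ d)⁻¹ := by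
  unfold gaussianKernel
  refine mul_le_of_le_one_right (by positivity) (Real.exp_le_one_iff.2 ?_)
  rw [neg_div, neg_nonpos]
  positivity

theorem noiseLevel_pos (ht : 0 < t) : 0 < noiseLevel t := by
  unfold noiseLevel
  refine Real.sqrt_pos.2 ?_
  have : Real.exp (-2 * t) < 1 := by
    simpa using Real.exp_lt_exp.2 (show -2 * t < 0 by linarith)
  linarith

theorem noiseLevel_le_one : noiseLevel t ≤ 1 := by
  unfold noiseLevel
  refine Real.sqrt_le_one.2 ?_
  linarith [Real.exp_pos (-2 * t)]

theorem sqrt_pow_eq_rpow {a : ℝ} (ha : 0 ≤ a) (d : ℕ) : Real.sqrt a ^ d = a ^ ((d : ℝ) / 2) := by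
  rw [Real.sqrt_eq_rpow, ← Real.rpow_mul_natCast ha]
  congr 1; ring

theorem integral_exp_neg_mul_sq_norm {b : ℝ} (hb : 0 < b) :
    ∫ v : EuclideanSpace ℝ (Fin d), Real.exp (-b * ‖v‖ ^ 2) = Real.sqrt (Real.pi / b) ^ d := by
  rw [GaussianFourier.integral_rexp_neg_mul_sq_norm hb, sqrt_pow_eq_rpow (by positivity)]
  simp

theorem integrable_exp_neg_mul_sq_norm {b : ℝ} (hb : 0 < b) :
    Integrable fun v : EuclideanSpace ℝ (Fin d) => Real.exp (-b * ‖v‖ ^ 2) := by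
  refine Integrable.of_integral_ne_zero ?_
  rw [integral_exp_neg_mul_sq_norm hb]
  positivity

theorem gaussianKernel_eq (v : EuclideanSpace ℝ (Fin d)) :
    gaussianKernel s v
      = (Real.sqrt (2 * Real.pi * s ^ 2) ^ d)⁻¹ * Real.exp (-(1 / (2 * s ^ 2)) * ‖v‖ ^ 2) := by
  unfold gaussianKernel
  congr 2; ring

theorem integral_gaussianKernel (hs : 0 < s) :
    ∫ v : EuclideanSpace ℝ (Fin d), gaussianKernel s v = 1 := by
  simp_rw [gaussianKernel_eq]
  rw [integral_const_mul, integral_exp_neg_mul_sq_norm (by positivity)]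
  have : Real.pi / (1 / (2 * s ^ 2)) = 2 * Real.pi * s ^ 2 := by field_simp
  rw [this]
  exact inv_mul_cancel₀ (by positivity)

theorem integrable_gaussianKernel (hs : 0 < s) :
    Integrable (gaussianKernel s : EuclideanSpace ℝ (Fin d) → ℝ) := by
  refine Integrable.of_integral_ne_zero ?_
  rw [integral_gaussianKernel hs]
  exact one_ne_zero

/-- The Gaussian distribution has the expected density: the characteristic functions agree. -/
theorem noise_eq_withDensity (ht : 0 < t) :
    noise d t = volume.withDensity fun v => ENNReal.ofReal (gaussianKernel (noiseLevel t) v) := by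
  have hs := noiseLevel_pos ht
  set s := noiseLevel t
  have hp : IsProbabilityMeasure ((volume : Measure (EuclideanSpace ℝ (Fin d))).withDensity
      fun v => ENNReal.ofReal (gaussianKernel s v)) := by
    refine ⟨?_⟩
    rw [withDensity_apply _ MeasurableSet.univ, Measure.restrict_univ,
      ← ofReal_integral_eq_lintegral_ofReal (integrable_gaussianKernel hs)
        (ae_of_all _ fun v => (gaussianKernel_pos hs v).le), integral_gaussianKernel hs]
    simp
  have hn : IsProbabilityMeasure (noise d t) :=
    Measure.isProbabilityMeasure_map (by fun_prop)
  refine Measure.ext_of_charFun ?_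
  ext w
  have hL : charFun (noise d t) w = Complex.exp (-(s ^ 2 * ‖w‖ ^ 2 / 2 : ℝ)) := by
    unfold noise
    rw [charFun_map_smul, charFun_stdGaussian, norm_smul, Real.norm_of_nonneg hs.le]
    congr 1
    push_cast
    ring
  rw [hL, charFun_apply, integral_withDensity_eq_integral_toReal_smul
    (continuous_gaussianKernel.measurable.ennreal_ofReal) (by simp)]
  have hb : (0 : ℝ) < ((1 / (2 * s ^ 2) : ℝ) : ℂ).re := by
    rw [Complex.ofReal_re]; positivity
  have key := GaussianFourier.integral_cexp_neg_mul_sq_norm_add hb Complex.I w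
  have hint : ∀ v : EuclideanSpace ℝ (Fin d),
      (ENNReal.ofReal (gaussianKernel s v)).toReal • Complex.exp ((inner ℝ v w : ℝ) * Complex.I)
      = (((Real.sqrt (2 * Real.pi * s ^ 2) ^ d)⁻¹ : ℝ) : ℂ) *
        Complex.exp (-((1 / (2 * s ^ 2) : ℝ) : ℂ) * (‖v‖ : ℂ) ^ 2
          + Complex.I * (inner ℝ w v : ℝ)) := by
    intro v
    rw [ENNReal.toReal_ofReal (gaussianKernel_pos hs v).le, gaussianKernel_eq, Complex.real_smul,
      Complex.exp_add, real_inner_comm]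
    push_cast
    ring_nf
  simp_rw [hint]
  rw [integral_const_mul, key]
  have h1 : ((Real.pi : ℂ) / ((1 / (2 * s ^ 2) : ℝ) : ℂ))
      ^ ((Module.finrank ℝ (EuclideanSpace ℝ (Fin d)) : ℂ) / 2)
      = ((Real.sqrt (2 * Real.pi * s ^ 2) ^ d : ℝ) : ℂ) := by
    rw [sqrt_pow_eq_rpow (by positivity), Complex.ofReal_cpow (by positivity)]
    have h2 : (Real.pi : ℂ) / ((1 / (2 * s ^ 2) : ℝ) : ℂ) = ((2 * Real.pi * s ^ 2 : ℝ) : ℂ) := by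
      push_cast
      field_simp
    rw [h2]
    congr 1
    simp
  rw [h1, ← mul_assoc, ← Complex.ofReal_mul, inv_mul_cancel₀ (by positivity)]
  rw [Complex.ofReal_one, one_mul]
  congr 1
  have hs' : (s : ℂ) ≠ 0 := by exact_mod_cast hs.ne'
  push_cast
  rw [Complex.I_sq]
  field_simp
  norm_num

instance isProbabilityMeasure_noise : IsProbabilityMeasure (noise d t) :=
  Measure.isProbabilityMeasure_map (by fun_prop)

instance isProbabilityMeasure_sampleLaw (q₀ : Measure (EuclideanSpace ℝ (Fin d)))
    [IsProbabilityMeasure q₀] : IsProbabilityMeasure (sampleLaw q₀ t) := by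
  unfold sampleLaw; infer_instance

theorem measurable_noised : Measurable (noised t : EuclideanSpace ℝ (Fin d) × _ → _) := by
  unfold noised; fun_prop

instance isProbabilityMeasure_smoothed (q₀ : Measure (EuclideanSpace ℝ (Fin d)))
    [IsProbabilityMeasure q₀] : IsProbabilityMeasure (smoothed q₀ t) :=
  Measure.isProbabilityMeasure_map measurable_noised.aemeasurable

/-- The Gaussian moment `E exp(‖z‖² / (4 σ²))`, which equals `2^{d/2}`, is at most `2^d`. -/
theorem lintegral_exp_noise_le (ht : 0 < t) :
    ∫⁻ z, ENNReal.ofReal (Real.exp (‖z‖ ^ 2 / (4 * noiseLevel t ^ 2))) ∂(noise d t)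
      ≤ ENNReal.ofReal (2 ^ d) := by
  have hs := noiseLevel_pos ht
  rw [noise_eq_withDensity ht]
  set s := noiseLevel t
  rw [lintegral_withDensity_eq_lintegral_mul _
    continuous_gaussianKernel.measurable.ennreal_ofReal (by fun_prop)]
  have h1 : ∀ v : EuclideanSpace ℝ (Fin d),
      ENNReal.ofReal (gaussianKernel s v) * ENNReal.ofReal (Real.exp (‖v‖ ^ 2 / (4 * s ^ 2)))
      = ENNReal.ofReal ((Real.sqrt (2 * Real.pi * s ^ 2) ^ d)⁻¹ *
          Real.exp (-(1 / (4 * s ^ 2)) * ‖v‖ ^ 2)) := by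
    intro v
    rw [← ENNReal.ofReal_mul (gaussianKernel_pos hs v).le, gaussianKernel_eq,
      mul_assoc, ← Real.exp_add]
    congr 3
    field_simp
    ring
  simp_rw [Pi.mul_apply, h1]
  rw [← ofReal_integral_eq_lintegral_ofReal
    ((integrable_exp_neg_mul_sq_norm (by positivity)).const_mul _)
    (ae_of_all _ fun v => by positivity), integral_const_mul,
    integral_exp_neg_mul_sq_norm (by positivity)]
  refine ENNReal.ofReal_le_ofReal ?_
  rw [← inv_pow, ← mul_pow]
  refine pow_le_pow_left₀ (by positivity) ?_ d
  rw [inv_mul_le_iff₀ (by positivity)]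
  refine Real.sqrt_le_iff.2 ⟨by positivity, ?_⟩
  rw [mul_pow, Real.sq_sqrt (by positivity)]
  have : Real.pi / (1 / (4 * s ^ 2)) = 4 * (Real.pi * s ^ 2) := by field_simp
  rw [this]
  nlinarith [mul_pos Real.pi_pos (pow_pos hs 2)]

end

section

variable {d : ℕ} {s t : ℝ} {q₀ : Measure (EuclideanSpace ℝ (Fin d))}

/-! ### The posterior of the clean point and the score as a posterior mean -/

/-- The likelihood of `y` given the noised point `x`. -/
def likelihood (t : ℝ) (x y : EuclideanSpace ℝ (Fin d)) : ℝ :=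
  gaussianKernel (noiseLevel t) (x - Real.exp (-t) • y)

theorem likelihood_pos (ht : 0 < t) (x y : EuclideanSpace ℝ (Fin d)) : 0 < likelihood t x y :=
  gaussianKernel_pos (noiseLevel_pos ht) _

theorem measurable_likelihood :
    Measurable fun p : EuclideanSpace ℝ (Fin d) × EuclideanSpace ℝ (Fin d) =>
      likelihood t p.1 p.2 := by
  unfold likelihood
  exact continuous_gaussianKernel.measurable.comp (by fun_prop)

theorem measurable_likelihood_right (x : EuclideanSpace ℝ (Fin d)) :
    Measurable fun y => likelihood t x y := by
  unfold likelihood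
  exact continuous_gaussianKernel.measurable.comp (by fun_prop)

theorem smoothedDensity_eq (x : EuclideanSpace ℝ (Fin d)) :
    smoothedDensity q₀ t x = ∫ y, likelihood t x y ∂q₀ := rfl

theorem integrable_likelihood [IsProbabilityMeasure q₀] (ht : 0 < t)
    (x : EuclideanSpace ℝ (Fin d)) : Integrable (likelihood t x) q₀ := by
  refine Integrable.mono' (integrable_const (Real.sqrt (2 * Real.pi * noiseLevel t ^ 2) ^ d)⁻¹)
    (measurable_likelihood_right x).aestronglyMeasurable
    (ae_of_all _ fun y => ?_)
  rw [Real.norm_of_nonneg (likelihood_pos ht x y).le]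
  exact gaussianKernel_le _

theorem smoothedDensity_pos [IsProbabilityMeasure q₀] (ht : 0 < t)
    (x : EuclideanSpace ℝ (Fin d)) : 0 < smoothedDensity q₀ t x := by
  rw [smoothedDensity_eq, integral_pos_iff_support_of_nonneg (fun y => (likelihood_pos ht x y).le)
    (integrable_likelihood ht x)]
  have : Function.support (likelihood t x) = Set.univ :=
    Set.eq_univ_of_forall fun y => (likelihood_pos ht x y).ne'
  simp [this]

theorem lintegral_likelihood [IsProbabilityMeasure q₀] (ht : 0 < t)
    (x : EuclideanSpace ℝ (Fin d)) :
    ∫⁻ y, ENNReal.ofReal (likelihood t x y) ∂q₀ = ENNReal.ofReal (smoothedDensity q₀ t x) := by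
  rw [smoothedDensity_eq, ofReal_integral_eq_lintegral_ofReal (integrable_likelihood ht x)
    (ae_of_all _ fun y => (likelihood_pos ht x y).le)]

/-- The law of the clean point `y` given the noised point `x`. -/
def posterior (q₀ : Measure (EuclideanSpace ℝ (Fin d))) (t : ℝ) (x : EuclideanSpace ℝ (Fin d)) :
    Measure (EuclideanSpace ℝ (Fin d)) :=
  (ENNReal.ofReal (smoothedDensity q₀ t x))⁻¹ •
    q₀.withDensity fun y => ENNReal.ofReal (likelihood t x y)

theorem isProbabilityMeasure_posterior [IsProbabilityMeasure q₀] (ht : 0 < t)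
    (x : EuclideanSpace ℝ (Fin d)) : IsProbabilityMeasure (posterior q₀ t x) := by
  refine ⟨?_⟩
  rw [posterior, Measure.smul_apply, withDensity_apply _ MeasurableSet.univ,
    Measure.restrict_univ, lintegral_likelihood ht, smul_eq_mul]
  exact ENNReal.inv_mul_cancel (by simpa using smoothedDensity_pos ht x) ENNReal.ofReal_ne_top

theorem lintegral_posterior (x : EuclideanSpace ℝ (Fin d))
    {F : EuclideanSpace ℝ (Fin d) → ENNReal} (hF : Measurable F) :
    ∫⁻ y, F y ∂(posterior q₀ t x) = (ENNReal.ofReal (smoothedDensity q₀ t x))⁻¹ *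
      ∫⁻ y, ENNReal.ofReal (likelihood t x y) * F y ∂q₀ := by
  rw [posterior, lintegral_smul_measure, smul_eq_mul, lintegral_withDensity_eq_lintegral_mul _
    (measurable_likelihood_right x).ennreal_ofReal hF]
  rfl

theorem integral_posterior [IsProbabilityMeasure q₀] (ht : 0 < t) (x : EuclideanSpace ℝ (Fin d))
    {E : Type*} [NormedAddCommGroup E] [NormedSpace ℝ E] (F : EuclideanSpace ℝ (Fin d) → E) :
    ∫ y, F y ∂(posterior q₀ t x) = (smoothedDensity q₀ t x)⁻¹ •
      ∫ y, likelihood t x y • F y ∂q₀ := by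
  rw [posterior, integral_smul_measure, integral_withDensity_eq_integral_toReal_smul
    (measurable_likelihood_right x).ennreal_ofReal (by simp)]
  simp_rw [ENNReal.toReal_inv, ENNReal.toReal_ofReal (smoothedDensity_pos ht x).le,
    ENNReal.toReal_ofReal (likelihood_pos ht x _).le]

theorem measurable_smoothedDensity [IsProbabilityMeasure q₀] :
    Measurable (smoothedDensity q₀ t) := by
  have : StronglyMeasurable fun x => ∫ y, likelihood t x y ∂q₀ :=
    StronglyMeasurable.integral_prod_right (f := fun x y => likelihood t x y)
      measurable_likelihood.stronglyMeasurable
  exact this.measurable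

theorem lintegral_sampleLaw [IsProbabilityMeasure q₀] (ht : 0 < t)
    {F : EuclideanSpace ℝ (Fin d) × EuclideanSpace ℝ (Fin d) → ENNReal} (hF : Measurable F) :
    ∫⁻ p, F p ∂(sampleLaw q₀ t) = ∫⁻ x, ∫⁻ y, ENNReal.ofReal (likelihood t x y) *
      F (y, x - Real.exp (-t) • y) ∂q₀ := by
  have h1 : Measurable fun p : EuclideanSpace ℝ (Fin d) × EuclideanSpace ℝ (Fin d) =>
      ENNReal.ofReal (likelihood t p.1 p.2) * F (p.2, p.1 - Real.exp (-t) • p.2) :=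
    measurable_likelihood.ennreal_ofReal.mul (hF.comp (by fun_prop))
  rw [sampleLaw, lintegral_prod _ hF.aemeasurable,
    lintegral_lintegral_swap (f := fun x y => ENNReal.ofReal (likelihood t x y) *
      F (y, x - Real.exp (-t) • y)) h1.aemeasurable]
  refine lintegral_congr fun y => ?_
  have hFy : Measurable fun z => F (y, z) := hF.comp measurable_prodMk_left
  rw [noise_eq_withDensity ht, lintegral_withDensity_eq_lintegral_mul _
    continuous_gaussianKernel.measurable.ennreal_ofReal hFy,
    ← lintegral_sub_right_eq_self _ (Real.exp (-t) • y)]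
  rfl

theorem lintegral_smoothed [IsProbabilityMeasure q₀] (ht : 0 < t)
    {H : EuclideanSpace ℝ (Fin d) → ENNReal} (hH : Measurable H) :
    ∫⁻ x, H x ∂(smoothed q₀ t) = ∫⁻ x, ENNReal.ofReal (smoothedDensity q₀ t x) * H x := by
  have hH' : Measurable fun p : EuclideanSpace ℝ (Fin d) × EuclideanSpace ℝ (Fin d) =>
      H (noised t p) := hH.comp measurable_noised
  rw [smoothed, lintegral_map hH measurable_noised, lintegral_sampleLaw ht hH']
  refine lintegral_congr fun x => ?_
  simp only [noised, add_sub_cancel]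
  rw [lintegral_mul_const _ (measurable_likelihood_right x).ennreal_ofReal, lintegral_likelihood ht]

theorem measurable_lintegral_posterior [IsProbabilityMeasure q₀]
    {F : EuclideanSpace ℝ (Fin d) → EuclideanSpace ℝ (Fin d) → ENNReal}
    (hF : Measurable (Function.uncurry F)) :
    Measurable fun x => ∫⁻ y, F x y ∂(posterior q₀ t x) := by
  have : ∀ x, Measurable (F x) := fun x => hF.comp measurable_prodMk_left
  simp_rw [fun x => lintegral_posterior (q₀ := q₀) (t := t) x (this x)]
  exact measurable_smoothedDensity.ennreal_ofReal.inv.mul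
    (Measurable.lintegral_prod_right' (f := fun p => ENNReal.ofReal (likelihood t p.1 p.2) *
      F p.1 p.2) (measurable_likelihood.ennreal_ofReal.mul hF))

/-- A sample can be drawn by first drawing the noised point and then the clean point from its
posterior. -/
theorem lintegral_sampleLaw_eq_posterior [IsProbabilityMeasure q₀] (ht : 0 < t)
    {F : EuclideanSpace ℝ (Fin d) × EuclideanSpace ℝ (Fin d) → ENNReal} (hF : Measurable F) :
    ∫⁻ p, F p ∂(sampleLaw q₀ t) =
      ∫⁻ x, ∫⁻ y, F (y, x - Real.exp (-t) • y) ∂(posterior q₀ t x) ∂(smoothed q₀ t) := by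
  have hF' : Measurable (Function.uncurry fun x y : EuclideanSpace ℝ (Fin d) =>
      F (y, x - Real.exp (-t) • y)) := hF.comp (by fun_prop)
  rw [lintegral_sampleLaw ht hF, lintegral_smoothed ht (measurable_lintegral_posterior hF')]
  refine lintegral_congr fun x => ?_
  have hFx : Measurable fun y => F (y, x - Real.exp (-t) • y) :=
    hF.comp (by fun_prop)
  rw [lintegral_posterior x hFx, ← mul_assoc,
    ENNReal.mul_inv_cancel (by simpa using smoothedDensity_pos ht x) ENNReal.ofReal_ne_top, one_mul]

/-- The regression target `-z / σ_t²` of score matching, as a function of the noise `z`. -/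
def target (t : ℝ) (z : EuclideanSpace ℝ (Fin d)) : EuclideanSpace ℝ (Fin d) :=
  (-(1 / noiseLevel t ^ 2)) • z

theorem continuous_target : Continuous (target t : EuclideanSpace ℝ (Fin d) → _) := by
  unfold target; fun_prop

theorem hasFDerivAt_likelihood (ht : 0 < t) (x y : EuclideanSpace ℝ (Fin d)) :
    HasFDerivAt (fun x => likelihood t x y)
      (likelihood t x y • innerSL ℝ (target t (x - Real.exp (-t) • y))) x := by
  have hs := noiseLevel_pos ht
  have h1 : HasFDerivAt (fun x : EuclideanSpace ℝ (Fin d) => x - Real.exp (-t) • y)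
      (ContinuousLinearMap.id ℝ _) x := (hasFDerivAt_id x).sub_const _
  have h2 := (((h1.norm_sq.neg.mul_const (2 * noiseLevel t ^ 2)⁻¹).exp).const_mul
    (Real.sqrt (2 * Real.pi * noiseLevel t ^ 2) ^ d)⁻¹)
  refine h2.congr_fderiv ?_
  ext v
  simp [likelihood, gaussianKernel, target, div_eq_mul_inv]
  field_simp

/-- The gradient of the likelihood is bounded uniformly in `x` and `y`, which allows
differentiation under the integral without any moment assumption on `q₀`. -/
theorem norm_likelihood_smul_target_le (ht : 0 < t) (x y : EuclideanSpace ℝ (Fin d)) :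
    ‖likelihood t x y • target t (x - Real.exp (-t) • y)‖
      ≤ (Real.sqrt (2 * Real.pi * noiseLevel t ^ 2) ^ d)⁻¹ * (1 / noiseLevel t) := by
  have hs := noiseLevel_pos ht
  unfold likelihood gaussianKernel target
  set s := noiseLevel t
  set v := x - Real.exp (-t) • y
  rw [norm_smul, norm_smul, norm_neg, Real.norm_of_nonneg (by positivity),
    Real.norm_of_nonneg (by positivity), mul_assoc]
  gcongr
  have h1 : ‖v‖ / s ≤ Real.exp (‖v‖ ^ 2 / (2 * s ^ 2)) := by
    refine le_trans ?_ (Real.add_one_le_exp _)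
    have : ‖v‖ ^ 2 / (2 * s ^ 2) = (‖v‖ / s) ^ 2 / 2 := by field_simp
    rw [this]
    nlinarith [sq_nonneg (‖v‖ / s - 1)]
  rw [neg_div, Real.exp_neg]
  rw [inv_mul_le_iff₀ (Real.exp_pos _)]
  calc 1 / s ^ 2 * ‖v‖ = (‖v‖ / s) * (1 / s) := by field_simp
    _ ≤ _ := by gcongr

/-- The score is the posterior mean of the regression target. -/
theorem score_eq_integral_posterior [IsProbabilityMeasure q₀] (ht : 0 < t)
    (x : EuclideanSpace ℝ (Fin d)) :
    score q₀ t x = ∫ y, target t (x - Real.exp (-t) • y) ∂(posterior q₀ t x) := by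
  have hmeas : ∀ x : EuclideanSpace ℝ (Fin d), AEStronglyMeasurable
      (fun y => likelihood t x y • target t (x - Real.exp (-t) • y)) q₀ := fun x =>
    ((measurable_likelihood_right x).smul
      (continuous_target.measurable.comp (by fun_prop))).aestronglyMeasurable
  have hint : Integrable (fun y => likelihood t x y • target t (x - Real.exp (-t) • y)) q₀ :=
    Integrable.mono' (integrable_const _) (hmeas x)
      (ae_of_all _ fun y => norm_likelihood_smul_target_le ht x y)
  have hder := hasFDerivAt_integral_of_dominated_of_fderiv_le (μ := q₀) (𝕜 := ℝ)
    (F := fun x y => likelihood t x y) (x₀ := x) (s := Set.univ)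
    (F' := fun x y => likelihood t x y • innerSL ℝ (target t (x - Real.exp (-t) • y)))
    (bound := fun _ => (Real.sqrt (2 * Real.pi * noiseLevel t ^ 2) ^ d)⁻¹ * (1 / noiseLevel t))
    Filter.univ_mem
    (Filter.Eventually.of_forall fun x => (measurable_likelihood_right x).aestronglyMeasurable)
    (integrable_likelihood ht x)
    (by
      have := (innerSL ℝ (E := EuclideanSpace ℝ (Fin d))).continuous.comp_aestronglyMeasurable
        (hmeas x)
      simpa using this)
    (ae_of_all _ fun y x _ => by
      simpa [norm_smul] using norm_likelihood_smul_target_le ht x y)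
    (integrable_const _)
    (ae_of_all _ fun y x _ => hasFDerivAt_likelihood ht x y)
  have hpos := smoothedDensity_pos (q₀ := q₀) ht x
  have hlog := hder.log hpos.ne'
  rw [integral_posterior ht]
  refine HasGradientAt.gradient ?_
  rw [hasGradientAt_iff_hasFDerivAt]
  refine hlog.congr_fderiv ?_
  ext v
  have hF' : Integrable
      (fun y => likelihood t x y • innerSL ℝ (target t (x - Real.exp (-t) • y))) q₀ := by
    refine Integrable.mono' (integrable_const
      ((Real.sqrt (2 * Real.pi * noiseLevel t ^ 2) ^ d)⁻¹ * (1 / noiseLevel t))) ?_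
      (ae_of_all _ fun y => by
        simpa [norm_smul] using norm_likelihood_smul_target_le ht x y)
    have := (innerSL ℝ (E := EuclideanSpace ℝ (Fin d))).continuous.comp_aestronglyMeasurable
        (hmeas x)
    simpa using this
  rw [InnerProductSpace.toDual_apply_apply, inner_smul_left, smul_apply,
    ContinuousLinearMap.integral_apply hF', real_inner_comm, ← integral_inner hint]
  simp [inner_smul_right, real_inner_comm v, smoothedDensity_eq]

theorem measurable_score : Measurable (score q₀ t) :=
  (InnerProductSpace.toDual ℝ _).symm.continuous.measurable.comp (measurable_fderiv ℝ _)

end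

section

/-! ### Centred vectors with a Gaussian moment are sub-Gaussian -/

section SubGaussian

variable {Ω : Type*} [MeasurableSpace Ω] {μ : Measure Ω} [IsProbabilityMeasure μ]

theorem exp_le_add_exp_sq (u : ℝ) : Real.exp u ≤ u + Real.exp (u ^ 2) := by
  have h1 := Real.add_one_le_exp (u ^ 2)
  rcases le_or_gt |u| 1 with h | h
  · have h2 := (abs_le.1 (Real.abs_exp_sub_one_sub_id_le h)).2
    linarith
  · rcases lt_abs.1 h with h | h
    · have : Real.exp u ≤ Real.exp (u ^ 2) := Real.exp_le_exp.2 (by nlinarith)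
      linarith
    · have : Real.exp u ≤ 1 := Real.exp_le_one_iff.2 (by linarith)
      nlinarith

/-- Jensen's inequality for `x ↦ x ^ θ` with `0 ≤ θ ≤ 1`, in exponential form. -/
theorem integral_exp_mul_le {W : Ω → ℝ} {L θ : ℝ} (hW : AEStronglyMeasurable W μ)
    (hint : Integrable (fun ω => Real.exp (W ω)) μ) (hL : ∫ ω, Real.exp (W ω) ∂μ ≤ Real.exp L)
    (h0 : 0 ≤ θ) (h1 : θ ≤ 1) :
    Integrable (fun ω => Real.exp (θ * W ω)) μ ∧
      ∫ ω, Real.exp (θ * W ω) ∂μ ≤ Real.exp (θ * L) := by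
  -- the tangent line of `x ↦ x ^ θ` at `x = exp L`
  have key : ∀ w : ℝ, Real.exp (θ * w)
      ≤ Real.exp (θ * L) * (1 - θ) + Real.exp (θ * L) * θ * Real.exp (-L) * Real.exp w := by
    intro w
    have := convexOn_exp.2 (Set.mem_univ (w - L)) (Set.mem_univ 0) h0
      (by linarith : 0 ≤ 1 - θ) (by ring)
    simp only [smul_eq_mul, mul_zero, add_zero, Real.exp_zero, mul_one] at this
    have e1 : Real.exp (θ * w) = Real.exp (θ * L) * Real.exp (θ * (w - L)) := by
      rw [← Real.exp_add]; ring_nf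
    have e2 : Real.exp (w - L) = Real.exp (-L) * Real.exp w := by
      rw [← Real.exp_add]; ring_nf
    rw [e2] at this
    rw [e1]
    nlinarith [Real.exp_pos (θ * L)]
  have hI : Integrable (fun ω => Real.exp (θ * L) * (1 - θ)
      + Real.exp (θ * L) * θ * Real.exp (-L) * Real.exp (W ω)) μ :=
    (integrable_const _).add (hint.const_mul _)
  have hI' : Integrable (fun ω => Real.exp (θ * W ω)) μ :=
    Integrable.mono' hI (Real.continuous_exp.comp_aestronglyMeasurable (hW.const_mul θ))
      (ae_of_all _ fun ω => by
        rw [Real.norm_of_nonneg (Real.exp_pos _).le]; exact key _)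
  refine ⟨hI', (integral_mono hI' hI fun ω => key (W ω)).trans ?_⟩
  rw [integral_add (integrable_const _) (hint.const_mul _), integral_const, integral_const_mul]
  simp only [probReal_univ, one_smul]
  have e3 : Real.exp (-L) * ∫ ω, Real.exp (W ω) ∂μ ≤ 1 := by
    rw [Real.exp_neg, inv_mul_le_iff₀ (Real.exp_pos _), mul_one]; exact hL
  have e4 : 0 ≤ Real.exp (θ * L) * θ := mul_nonneg (Real.exp_pos _).le h0
  nlinarith [mul_le_mul_of_nonneg_left e3 e4]

variable {E : Type*} [NormedAddCommGroup E] [InnerProductSpace ℝ E] [CompleteSpace E]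

/-- A Gaussian moment `E exp(c ‖Y‖²) ≤ B` makes `Y - E Y` sub-Gaussian with variance proxy of
order `log B / c`. For small `v` this uses `exp u ≤ u + exp(u²)`, whose linear term has mean zero;
for large `v` the Gaussian moment suffices. -/
theorem integral_exp_inner_sub_mean_le {Y : Ω → E} {c B : ℝ} (hY : AEStronglyMeasurable Y μ)
    (hc : 0 < c) (hB : 2 ≤ B) (hint : Integrable (fun ω => Real.exp (c * ‖Y ω‖ ^ 2)) μ)
    (hle : ∫ ω, Real.exp (c * ‖Y ω‖ ^ 2) ∂μ ≤ B) (v : E) :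
    Integrable (fun ω => Real.exp (inner ℝ v (Y ω - ∫ ω, Y ω ∂μ))) μ ∧
      ∫ ω, Real.exp (inner ℝ v (Y ω - ∫ ω, Y ω ∂μ)) ∂μ
        ≤ Real.exp (4 * ‖v‖ ^ 2 * Real.log B / c) := by
  have hB0 : 0 < B := by linarith
  have hℓ : 1 / 2 ≤ Real.log B := by
    have := Real.log_le_log (by norm_num) hB
    linarith [Real.log_two_gt_d9]
  have hYint : Integrable Y μ := by
    refine Integrable.mono' (hint.const_mul (1 + 1 / c)) hY (ae_of_all _ fun ω => ?_)
    have h1 := Real.add_one_le_exp (c * ‖Y ω‖ ^ 2)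
    have h2 : ‖Y ω‖ ^ 2 = (1 / c) * (c * ‖Y ω‖ ^ 2) := by field_simp
    have h3 : (1 / c) * (c * ‖Y ω‖ ^ 2) ≤ (1 / c) * Real.exp (c * ‖Y ω‖ ^ 2) := by
      gcongr; linarith
    have h4 : 1 ≤ Real.exp (c * ‖Y ω‖ ^ 2) := Real.one_le_exp (by positivity)
    nlinarith [sq_nonneg (‖Y ω‖ - 1)]
  set s := ∫ ω, Y ω ∂μ with hs
  have hYs : Integrable (fun ω => Y ω - s) μ := hYint.sub (integrable_const _)
  have hzero : ∀ w : E, ∫ ω, inner ℝ w (Y ω - s) ∂μ = 0 := by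
    intro w
    rw [integral_inner hYs, integral_sub hYint (integrable_const _), integral_const]
    simp [hs]
  have hinn : ∀ w : E, Integrable (fun ω => inner ℝ w (Y ω - s)) μ := fun w =>
    hYs.const_inner w
  -- `exp(c ‖·‖²)` at the mean, by Jensen's inequality
  have hmean : Real.exp (c * ‖s‖ ^ 2) ≤ B := by
    refine le_trans ?_ hle
    have hlow : ∀ ω, Real.exp (c * ‖s‖ ^ 2) * (1 + 2 * c * inner ℝ s (Y ω - s))
        ≤ Real.exp (c * ‖Y ω‖ ^ 2) := by
      intro ω
      have h1 : c * ‖s‖ ^ 2 + 2 * c * inner ℝ s (Y ω - s) ≤ c * ‖Y ω‖ ^ 2 := by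
        have : ‖Y ω‖ ^ 2 = ‖s‖ ^ 2 + 2 * inner ℝ s (Y ω - s) + ‖Y ω - s‖ ^ 2 := by
          rw [← norm_add_sq_real]; congr 2; abel
        rw [this]
        nlinarith [sq_nonneg ‖Y ω - s‖]
      refine le_trans ?_ (Real.exp_le_exp.2 h1)
      rw [Real.exp_add]
      gcongr
      linarith [Real.add_one_le_exp (2 * c * inner ℝ s (Y ω - s))]
    have hi : Integrable (fun ω => Real.exp (c * ‖s‖ ^ 2) *
        (1 + 2 * c * inner ℝ s (Y ω - s))) μ :=
      ((integrable_const _).add ((hinn s).const_mul _)).const_mul _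
    refine le_trans (le_of_eq ?_) (integral_mono hi hint hlow)
    rw [integral_const_mul, integral_add (integrable_const _) ((hinn s).const_mul _),
      integral_const_mul, hzero]
    simp
  have hW : AEStronglyMeasurable (fun ω => c / 2 * ‖Y ω - s‖ ^ 2) μ :=
    ((hYs.1.norm.pow 2).const_mul _)
  -- the Gaussian moment of the centred vector, with half the exponent
  have hup : ∀ ω, Real.exp (c / 2 * ‖Y ω - s‖ ^ 2)
      ≤ Real.exp (c * ‖s‖ ^ 2) * Real.exp (c * ‖Y ω‖ ^ 2) := by
    intro ω
    rw [← Real.exp_add]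
    refine Real.exp_le_exp.2 ?_
    have h1 := norm_sub_le (Y ω) s
    have h2 : ‖Y ω - s‖ ^ 2 ≤ 2 * (‖Y ω‖ ^ 2 + ‖s‖ ^ 2) := by
      nlinarith [norm_nonneg (Y ω - s), sq_nonneg (‖Y ω‖ - ‖s‖)]
    nlinarith
  have hWint : Integrable (fun ω => Real.exp (c / 2 * ‖Y ω - s‖ ^ 2)) μ :=
    Integrable.mono' (hint.const_mul _) (Real.continuous_exp.comp_aestronglyMeasurable hW)
      (ae_of_all _ fun ω => by rw [Real.norm_of_nonneg (Real.exp_pos _).le]; exact hup ω)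
  have hWle : ∫ ω, Real.exp (c / 2 * ‖Y ω - s‖ ^ 2) ∂μ ≤ Real.exp (2 * Real.log B) := by
    refine (integral_mono hWint (hint.const_mul _) hup).trans ?_
    rw [integral_const_mul, two_mul, Real.exp_add, Real.exp_log hB0]
    exact mul_le_mul hmean hle (integral_nonneg fun _ => (Real.exp_pos _).le) hB0.le
  have hmeas : AEStronglyMeasurable (fun ω => Real.exp (inner ℝ v (Y ω - s))) μ :=
    Real.continuous_exp.comp_aestronglyMeasurable (hinn v).1
  have hcs : ∀ ω, |inner ℝ v (Y ω - s)| ≤ ‖v‖ * ‖Y ω - s‖ := fun ω =>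
    abs_real_inner_le_norm _ _
  rcases le_or_gt (‖v‖ ^ 2) (c / 2) with hv | hv
  · obtain ⟨hI, hle2⟩ := integral_exp_mul_le (θ := ‖v‖ ^ 2 * 2 / c) hW hWint hWle (by positivity)
      (by rw [div_le_one hc]; linarith)
    have hpt : ∀ ω, Real.exp (inner ℝ v (Y ω - s)) ≤ inner ℝ v (Y ω - s)
        + Real.exp (‖v‖ ^ 2 * 2 / c * (c / 2 * ‖Y ω - s‖ ^ 2)) := by
      intro ω
      refine (exp_le_add_exp_sq _).trans ?_
      have e : ‖v‖ ^ 2 * 2 / c * (c / 2 * ‖Y ω - s‖ ^ 2) = (‖v‖ * ‖Y ω - s‖) ^ 2 := by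
        field_simp
      rw [e]
      gcongr _ + Real.exp ?_
      exact sq_le_sq' (abs_le.1 (hcs ω)).1 (abs_le.1 (hcs ω)).2
    have hI' := Integrable.mono' ((hinn v).add hI) hmeas (ae_of_all _ fun ω => by
      rw [Real.norm_of_nonneg (Real.exp_pos _).le]; exact hpt ω)
    refine ⟨hI', (integral_mono hI' ((hinn v).add hI) hpt).trans ?_⟩
    rw [integral_add' (hinn v) hI, hzero, zero_add]
    refine hle2.trans (le_of_eq ?_)
    congr 1; ring
  · obtain ⟨hI, hle2⟩ := integral_exp_mul_le (θ := 1 / 2) hW hWint hWle (by norm_num)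
      (by norm_num)
    have hpt : ∀ ω, Real.exp (inner ℝ v (Y ω - s)) ≤
        Real.exp (‖v‖ ^ 2 / c) * Real.exp (1 / 2 * (c / 2 * ‖Y ω - s‖ ^ 2)) := by
      intro ω
      rw [← Real.exp_add]
      refine Real.exp_le_exp.2 ((le_abs_self _).trans ((hcs ω).trans ?_))
      have e : ‖v‖ ^ 2 / c + 1 / 2 * (c / 2 * ‖Y ω - s‖ ^ 2) - ‖v‖ * ‖Y ω - s‖
          = (‖v‖ - c / 2 * ‖Y ω - s‖) ^ 2 / c := by field_simp; ring
      have : 0 ≤ (‖v‖ - c / 2 * ‖Y ω - s‖) ^ 2 / c := by positivity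
      linarith
    have hI' := Integrable.mono' (hI.const_mul (Real.exp (‖v‖ ^ 2 / c))) hmeas
      (ae_of_all _ fun ω => by rw [Real.norm_of_nonneg (Real.exp_pos _).le]; exact hpt ω)
    refine ⟨hI', (integral_mono hI' (hI.const_mul _) hpt).trans ?_⟩
    rw [integral_const_mul]
    refine (mul_le_mul_of_nonneg_left hle2 (Real.exp_pos _).le).trans ?_
    rw [← Real.exp_add]
    refine Real.exp_le_exp.2 ?_
    have hr : 1 / 2 < ‖v‖ ^ 2 / c := by rw [lt_div_iff₀ hc]; linarith
    have e : 4 * ‖v‖ ^ 2 * Real.log B / c = 4 * (‖v‖ ^ 2 / c) * Real.log B := by ring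
    rw [e]
    nlinarith

end SubGaussian

variable {d : ℕ} {t : ℝ} {q₀ : Measure (EuclideanSpace ℝ (Fin d))}

/-! ### Exponential moments of the regression noise -/

/-- The posterior Gaussian moment `E[exp(‖z‖² / (4 σ_t²)) | x]`. -/
def posteriorMoment (q₀ : Measure (EuclideanSpace ℝ (Fin d))) (t : ℝ)
    (x : EuclideanSpace ℝ (Fin d)) : ENNReal :=
  ∫⁻ y, ENNReal.ofReal (Real.exp (‖x - Real.exp (-t) • y‖ ^ 2 / (4 * noiseLevel t ^ 2)))
    ∂(posterior q₀ t x)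

/-- The noised points whose posterior Gaussian moment is at most `B`. -/
def typicalSet (q₀ : Measure (EuclideanSpace ℝ (Fin d))) (t B : ℝ) :
    Set (EuclideanSpace ℝ (Fin d)) :=
  {x | posteriorMoment q₀ t x ≤ ENNReal.ofReal B}

/-- The regression noise `-z / σ_t² - s_t(x)` of a sample; it has mean zero given `x`. -/
def residual (q₀ : Measure (EuclideanSpace ℝ (Fin d))) (t : ℝ)
    (p : EuclideanSpace ℝ (Fin d) × EuclideanSpace ℝ (Fin d)) : EuclideanSpace ℝ (Fin d) :=
  target t p.2 - score q₀ t (noised t p)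

theorem measurable_residual : Measurable (residual q₀ t) := by
  unfold residual
  exact (continuous_target.measurable.comp measurable_snd).sub
    (measurable_score.comp measurable_noised)

theorem measurable_posteriorMoment [IsProbabilityMeasure q₀] :
    Measurable (posteriorMoment q₀ t) :=
  measurable_lintegral_posterior (F := fun x y => ENNReal.ofReal (Real.exp
    (‖x - Real.exp (-t) • y‖ ^ 2 / (4 * noiseLevel t ^ 2)))) (by
      simp only [Function.uncurry_def]; fun_prop)

theorem measurableSet_typicalSet [IsProbabilityMeasure q₀] {B : ℝ} :
    MeasurableSet (typicalSet q₀ t B) :=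
  measurableSet_le measurable_posteriorMoment measurable_const

/-- Given a typical noised point, the regression noise is sub-Gaussian. -/
theorem lintegral_exp_inner_posterior_le [IsProbabilityMeasure q₀] (ht : 0 < t) {B : ℝ}
    (hB : 2 ≤ B) {x : EuclideanSpace ℝ (Fin d)} (hx : x ∈ typicalSet q₀ t B)
    (v : EuclideanSpace ℝ (Fin d)) :
    ∫⁻ y, ENNReal.ofReal (Real.exp
        (inner ℝ v (target t (x - Real.exp (-t) • y) - score q₀ t x))) ∂(posterior q₀ t x)
      ≤ ENNReal.ofReal (Real.exp (16 * ‖v‖ ^ 2 * Real.log B / noiseLevel t ^ 2)) := by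
  have hs := noiseLevel_pos ht
  have := isProbabilityMeasure_posterior (q₀ := q₀) ht x
  have hmeas : Measurable fun y : EuclideanSpace ℝ (Fin d) => target t (x - Real.exp (-t) • y) :=
    continuous_target.measurable.comp (by fun_prop)
  have hexp : ∀ y : EuclideanSpace ℝ (Fin d),
      Real.exp (noiseLevel t ^ 2 / 4 * ‖target t (x - Real.exp (-t) • y)‖ ^ 2)
        = Real.exp (‖x - Real.exp (-t) • y‖ ^ 2 / (4 * noiseLevel t ^ 2)) := by
    intro y
    rw [target, norm_smul, norm_neg, Real.norm_of_nonneg (by positivity)]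
    congr 1
    field_simp
  have hint : Integrable (fun y =>
      Real.exp (noiseLevel t ^ 2 / 4 * ‖target t (x - Real.exp (-t) • y)‖ ^ 2))
      (posterior q₀ t x) := by
    simp_rw [hexp]
    refine (lintegral_ofReal_ne_top_iff_integrable (Measurable.aestronglyMeasurable (by fun_prop))
      (ae_of_all _ fun y => (Real.exp_pos _).le)).1 ?_
    exact ne_top_of_le_ne_top ENNReal.ofReal_ne_top hx
  have hle : ∫ y, Real.exp (noiseLevel t ^ 2 / 4 * ‖target t (x - Real.exp (-t) • y)‖ ^ 2)
      ∂(posterior q₀ t x) ≤ B := by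
    refine (ENNReal.ofReal_le_ofReal_iff (by linarith)).1 ?_
    rw [ofReal_integral_eq_lintegral_ofReal hint (ae_of_all _ fun y => (Real.exp_pos _).le)]
    simp_rw [hexp]
    exact hx
  obtain ⟨h1, h2⟩ := integral_exp_inner_sub_mean_le hmeas.aestronglyMeasurable
    (by positivity) hB hint hle v
  rw [← score_eq_integral_posterior ht] at h1 h2
  rw [← ofReal_integral_eq_lintegral_ofReal h1 (ae_of_all _ fun y => (Real.exp_pos _).le)]
  refine ENNReal.ofReal_le_ofReal (h2.trans (le_of_eq ?_))
  congr 1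
  field_simp
  ring

/-- Both the test direction `g` and the weight `h` may depend on the noised point, because the bound
holds conditionally on it. -/
theorem lintegral_exp_inner_residual_le [IsProbabilityMeasure q₀] (ht : 0 < t) {B : ℝ}
    (hB : 2 ≤ B) {h : EuclideanSpace ℝ (Fin d) → ENNReal} (hh : Measurable h)
    {g : EuclideanSpace ℝ (Fin d) → EuclideanSpace ℝ (Fin d)} (hg : Measurable g) :
    ∫⁻ p, (typicalSet q₀ t B).indicator h (noised t p) *
        ENNReal.ofReal (Real.exp (inner ℝ (g (noised t p)) (residual q₀ t p))) ∂(sampleLaw q₀ t)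
      ≤ ∫⁻ x, h x * ENNReal.ofReal (Real.exp
        (16 * ‖g x‖ ^ 2 * Real.log B / noiseLevel t ^ 2)) ∂(smoothed q₀ t) := by
  have hind := (hh.indicator (measurableSet_typicalSet (q₀ := q₀) (t := t) (B := B)))
  have hmeas : Measurable fun p => (typicalSet q₀ t B).indicator h (noised t p) *
      ENNReal.ofReal (Real.exp (inner ℝ (g (noised t p)) (residual q₀ t p))) :=
    (hind.comp measurable_noised).mul (Real.measurable_exp.comp
      ((hg.comp measurable_noised).inner measurable_residual)).ennreal_ofReal
  rw [lintegral_sampleLaw_eq_posterior ht hmeas]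
  refine lintegral_mono fun x => ?_
  simp only [noised, residual, add_sub_cancel]
  by_cases hx : x ∈ typicalSet q₀ t B
  · rw [Set.indicator_of_mem hx, lintegral_const_mul]
    · gcongr
      exact lintegral_exp_inner_posterior_le ht hB hx (g x)
    · refine (Real.measurable_exp.comp (Measurable.const_inner ?_)).ennreal_ofReal
      exact (continuous_target.measurable.comp (by fun_prop)).sub_const _
  · simp [Set.indicator_of_notMem hx]

end

section

/-! ### Tail bounds for independent samples -/

section Iid

variable {Ω : Type*} [MeasurableSpace Ω] {μ : Measure Ω} [IsProbabilityMeasure μ] {m : ℕ}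

theorem lintegral_pi_eval {f : Ω → ENNReal} (hf : Measurable f) (i : Fin m) :
    ∫⁻ ω, f (ω i) ∂(Measure.pi fun _ : Fin m => μ) = ∫⁻ x, f x ∂μ :=
  (measurePreserving_eval (fun _ : Fin m => μ) i).lintegral_comp hf

theorem lintegral_pi_prod {f : Ω → ENNReal} (hf : Measurable f) :
    ∫⁻ ω, ∏ i, f (ω i) ∂(Measure.pi fun _ : Fin m => μ) = (∫⁻ x, f x ∂μ) ^ m := by
  have h := lintegral_prod_eq_prod_lintegral_of_indepFun Finset.univ
    (fun (i : Fin m) (ω : Fin m → Ω) => f (ω i))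
    (iIndepFun_pi (μ := fun _ : Fin m => μ) (X := fun _ => f) fun _ => hf.aemeasurable)
    (fun i => hf.comp (measurable_pi_apply i))
  rw [h]
  simp_rw [lintegral_pi_eval hf]
  simp

theorem measure_pi_exists_le {A : Set Ω} (hA : MeasurableSet A) :
    Measure.pi (fun _ : Fin m => μ) {ω | ∃ i, ω i ∈ A} ≤ m * μ A := by
  have : {ω : Fin m → Ω | ∃ i, ω i ∈ A} = ⋃ i, (fun ω => ω i) ⁻¹' A := by
    ext ω; simp
  rw [this]
  refine (measure_iUnion_fintype_le _ _).trans ?_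
  have h : ∀ i : Fin m, Measure.pi (fun _ : Fin m => μ) ((fun ω => ω i) ⁻¹' A) = μ A := fun i =>
    (measurePreserving_eval (fun _ : Fin m => μ) i).measure_preimage hA.nullMeasurableSet
  simp [h]

/-- Markov's inequality for a sum of nonnegative functions of the samples. -/
theorem measure_pi_sum_ge_le {f : Ω → ℝ} (hf : Measurable f) (hf0 : ∀ x, 0 ≤ f x) {u : ℝ}
    (hu : 0 < u) :
    Measure.pi (fun _ : Fin m => μ) {ω | u ≤ ∑ i, f (ω i)}
      ≤ (m * ∫⁻ x, ENNReal.ofReal (f x) ∂μ) / ENNReal.ofReal u := by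
  have hset : {ω : Fin m → Ω | u ≤ ∑ i, f (ω i)}
      = {ω | ENNReal.ofReal u ≤ ∑ i, ENNReal.ofReal (f (ω i))} := by
    ext ω
    simp only [Set.mem_ofPred_eq]
    rw [← ENNReal.ofReal_sum_of_nonneg fun i _ => hf0 _,
      ENNReal.ofReal_le_ofReal_iff (Finset.sum_nonneg fun i _ => hf0 _)]
  have hm : ∀ i : Fin m, Measurable fun ω : Fin m → Ω => ENNReal.ofReal (f (ω i)) := fun i =>
    (hf.comp (measurable_pi_apply i)).ennreal_ofReal
  rw [hset]
  refine (meas_ge_le_lintegral_div (Finset.measurable_fun_sum _ fun i _ => hm i).aemeasurable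
    (by simpa using hu) ENNReal.ofReal_ne_top).trans ?_
  rw [lintegral_finsetSum _ fun i _ => hm i]
  simp_rw [lintegral_pi_eval (f := fun x => ENNReal.ofReal (f x)) hf.ennreal_ofReal]
  simp

/-- Chernoff's inequality, restricted to the event that all samples lie in `A`. -/
theorem measure_pi_sum_ge_le_exp {A : Set Ω} (hA : MeasurableSet A) {W : Ω → ℝ}
    (hW : Measurable W) (u : ℝ) :
    Measure.pi (fun _ : Fin m => μ) {ω | (∀ i, ω i ∈ A) ∧ u ≤ ∑ i, W (ω i)}
      ≤ (∫⁻ x, A.indicator (fun x => ENNReal.ofReal (Real.exp (W x))) x ∂μ) ^ m *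
        ENNReal.ofReal (Real.exp (-u)) := by
  have hm : Measurable (A.indicator fun x => ENNReal.ofReal (Real.exp (W x))) :=
    (Real.measurable_exp.comp hW).ennreal_ofReal.indicator hA
  have hsub : {ω : Fin m → Ω | (∀ i, ω i ∈ A) ∧ u ≤ ∑ i, W (ω i)} ⊆
      {ω | ENNReal.ofReal (Real.exp u) ≤
        ∏ i, A.indicator (fun x => ENNReal.ofReal (Real.exp (W x))) (ω i)} := by
    rintro ω ⟨h1, h2⟩
    simp only [Set.mem_ofPred_eq]
    have : ∀ i ∈ Finset.univ, A.indicator (fun x => ENNReal.ofReal (Real.exp (W x))) (ω i)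
        = ENNReal.ofReal (Real.exp (W (ω i))) := fun i _ => Set.indicator_of_mem (h1 i) _
    rw [Finset.prod_congr rfl this, ← ENNReal.ofReal_prod_of_nonneg fun i _ => (Real.exp_pos _).le,
      ← Real.exp_sum]
    exact ENNReal.ofReal_le_ofReal (Real.exp_le_exp.2 h2)
  refine (measure_mono hsub).trans ?_
  have hm' : ∀ i : Fin m, Measurable fun ω : Fin m → Ω =>
      A.indicator (fun x => ENNReal.ofReal (Real.exp (W x))) (ω i) := fun i =>
    hm.comp (measurable_pi_apply i)
  refine (meas_ge_le_lintegral_div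
    (Finset.measurable_fun_prod _ fun i _ => hm' i).aemeasurable (by simpa using Real.exp_pos u)
    ENNReal.ofReal_ne_top).trans ?_
  rw [lintegral_pi_prod hm, div_eq_mul_inv, Real.exp_neg,
    ENNReal.ofReal_inv_of_pos (Real.exp_pos _)]

/-- If `φ ≥ 0` exceeds `r ≤ 1` with probability at least `p`, its Laplace transform is bounded
away from one. -/
theorem lintegral_exp_neg_le {φ : Ω → ℝ} (hφ : Measurable φ) (hφ0 : ∀ x, 0 ≤ φ x) {r p : ℝ}
    (hr0 : 0 ≤ r) (hr1 : r ≤ 1) (hp : ENNReal.ofReal p ≤ μ {x | r ≤ φ x}) :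
    ∫⁻ x, ENNReal.ofReal (Real.exp (-φ x)) ∂μ ≤ ENNReal.ofReal (Real.exp (-(p * r / 2))) := by
  have hA : MeasurableSet {x | r ≤ φ x} := measurableSet_le measurable_const hφ
  have hpt : ∀ x, ENNReal.ofReal (Real.exp (-φ x)) +
      {x | r ≤ φ x}.indicator (fun _ => ENNReal.ofReal (r / 2)) x ≤ 1 := by
    intro x
    by_cases hx : x ∈ {x | r ≤ φ x}
    · rw [Set.indicator_of_mem hx, ← ENNReal.ofReal_add (Real.exp_pos _).le (by positivity)]
      refine ENNReal.ofReal_le_one.2 ?_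
      have h1 : Real.exp (-φ x) ≤ Real.exp (-r) := Real.exp_le_exp.2 (neg_le_neg hx)
      have h2 : Real.exp (-r) ≤ 1 - r / 2 := by
        rw [Real.exp_neg]
        refine inv_le_of_inv_le₀ (by linarith) ?_
        refine le_trans ?_ (Real.add_one_le_exp r)
        rw [inv_le_iff_one_le_mul₀ (by linarith)]
        nlinarith
      linarith
    · rw [Set.indicator_of_notMem hx, add_zero]
      exact ENNReal.ofReal_le_one.2 (Real.exp_le_one_iff.2 (by linarith [hφ0 x]))
  have hint := lintegral_mono (μ := μ) hpt
  rw [lintegral_add_right _ (measurable_const.indicator hA), lintegral_indicator_const hA,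
    lintegral_const, measure_univ, mul_one] at hint
  have h3 : ∫⁻ x, ENNReal.ofReal (Real.exp (-φ x)) ∂μ + ENNReal.ofReal (p * r / 2) ≤ 1 := by
    refine le_trans ?_ hint
    gcongr
    calc ENNReal.ofReal (p * r / 2) = ENNReal.ofReal (r / 2 * p) := by congr 1; ring
      _ = ENNReal.ofReal (r / 2) * ENNReal.ofReal p := ENNReal.ofReal_mul (by positivity)
      _ ≤ _ := by gcongr
  refine (ENNReal.le_sub_of_add_le_right ENNReal.ofReal_ne_top h3).trans ?_
  rcases le_or_gt 0 (p * r / 2) with hpr | hpr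
  · rw [← ENNReal.ofReal_one, ← ENNReal.ofReal_sub _ hpr]
    refine ENNReal.ofReal_le_ofReal ?_
    linarith [Real.add_one_le_exp (-(p * r / 2))]
  · refine tsub_le_self.trans ?_
    rw [← ENNReal.ofReal_one]
    exact ENNReal.ofReal_le_ofReal (Real.one_le_exp (by linarith))

end Iid

variable {d m : ℕ} {t : ℝ} {q₀ : Measure (EuclideanSpace ℝ (Fin d))}

/-- Exponential tail bound for sums of a function of the noised points plus a linear functional of
the regression noise. -/
theorem measure_sum_residual_ge_le [IsProbabilityMeasure q₀] (ht : 0 < t) {B : ℝ}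
    (hB : 2 ≤ B) {w : EuclideanSpace ℝ (Fin d) → ℝ} (hw : Measurable w)
    {g : EuclideanSpace ℝ (Fin d) → EuclideanSpace ℝ (Fin d)} (hg : Measurable g) (u : ℝ) :
    Measure.pi (fun _ : Fin m => sampleLaw q₀ t)
        {ω | (∀ i, noised t (ω i) ∈ typicalSet q₀ t B) ∧
          u ≤ ∑ i, (w (noised t (ω i)) + inner ℝ (g (noised t (ω i))) (residual q₀ t (ω i)))}
      ≤ (∫⁻ x, ENNReal.ofReal (Real.exp (w x + 16 * ‖g x‖ ^ 2 * Real.log B / noiseLevel t ^ 2))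
          ∂(smoothed q₀ t)) ^ m * ENNReal.ofReal (Real.exp (-u)) := by
  have hA : MeasurableSet (noised t ⁻¹' typicalSet q₀ t B) :=
    measurable_noised (measurableSet_typicalSet (q₀ := q₀))
  refine (measure_pi_sum_ge_le_exp (μ := sampleLaw q₀ t) hA (W := fun p => w (noised t p) +
    inner ℝ (g (noised t p)) (residual q₀ t p)) (
      (hw.comp measurable_noised).add
        ((hg.comp measurable_noised).inner (measurable_residual (q₀ := q₀)))) u).trans ?_
  gcongr ?_ ^ m * _
  refine le_trans (le_of_eq ?_) ((lintegral_exp_inner_residual_le (q₀ := q₀) ht hB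
    (h := fun x => ENNReal.ofReal (Real.exp (w x)))
    (Real.measurable_exp.comp hw).ennreal_ofReal hg).trans (le_of_eq ?_))
  · refine lintegral_congr fun p => ?_
    by_cases hp : noised t p ∈ typicalSet q₀ t B
    · rw [Set.indicator_of_mem (show p ∈ noised t ⁻¹' typicalSet q₀ t B from hp),
        Set.indicator_of_mem hp, ← ENNReal.ofReal_mul (Real.exp_pos _).le, Real.exp_add]
    · rw [Set.indicator_of_notMem (show p ∉ noised t ⁻¹' typicalSet q₀ t B from hp),
        Set.indicator_of_notMem hp, zero_mul]
  · refine lintegral_congr fun x => ?_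
    rw [← ENNReal.ofReal_mul (Real.exp_pos _).le, Real.exp_add]

theorem lintegral_sampleLaw_snd [IsProbabilityMeasure q₀]
    {F : EuclideanSpace ℝ (Fin d) → ENNReal} (hF : Measurable F) :
    ∫⁻ p, F p.2 ∂(sampleLaw q₀ t) = ∫⁻ z, F z ∂(noise d t) := by
  rw [sampleLaw, ← lintegral_map hF measurable_snd, Measure.map_snd_prod]
  simp

theorem lintegral_sampleLaw_fst [IsProbabilityMeasure q₀]
    {F : EuclideanSpace ℝ (Fin d) → ENNReal} (hF : Measurable F) :
    ∫⁻ p, F p.1 ∂(sampleLaw q₀ t) = ∫⁻ y, F y ∂q₀ := by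
  rw [sampleLaw, ← lintegral_map hF measurable_fst, Measure.map_fst_prod]
  simp

/-! ### Typical samples -/

theorem measure_norm_fst_gt_le [IsProbabilityMeasure q₀] {m₂ κ : ℝ} (hκ : 0 < κ)
    (hint : Integrable (fun y => ‖y‖ ^ 2) q₀) (hm₂ : ∫ y, ‖y‖ ^ 2 ∂q₀ = m₂ ^ 2) (hm0 : 0 ≤ m₂) :
    sampleLaw q₀ t {p | max m₂ 1 / Real.sqrt κ < ‖p.1‖} ≤ ENNReal.ofReal κ := by
  have hM : 0 < max m₂ 1 := lt_max_of_lt_right one_pos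
  have hsub : {p : EuclideanSpace ℝ (Fin d) × EuclideanSpace ℝ (Fin d) |
      max m₂ 1 / Real.sqrt κ < ‖p.1‖} ⊆
      {p | ENNReal.ofReal (max m₂ 1 ^ 2 / κ) ≤ ENNReal.ofReal (‖p.1‖ ^ 2)} := by
    intro p hp
    refine ENNReal.ofReal_le_ofReal ?_
    have h1 : max m₂ 1 ^ 2 / κ = (max m₂ 1 / Real.sqrt κ) ^ 2 := by
      rw [div_pow, Real.sq_sqrt hκ.le]
    rw [h1]
    exact pow_le_pow_left₀ (by positivity) (le_of_lt hp) 2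
  refine (measure_mono hsub).trans ((meas_ge_le_lintegral_div
    (Measurable.aemeasurable (by fun_prop))
    (by simpa using (by positivity : 0 < max m₂ 1 ^ 2 / κ)) ENNReal.ofReal_ne_top).trans ?_)
  rw [lintegral_sampleLaw_fst (F := fun y => ENNReal.ofReal (‖y‖ ^ 2)) (by fun_prop),
    ← ofReal_integral_eq_lintegral_ofReal hint (ae_of_all _ fun y => by positivity), hm₂,
    ← ENNReal.ofReal_div_of_pos (by positivity)]
  refine ENNReal.ofReal_le_ofReal ?_
  rw [div_le_iff₀ (by positivity)]
  calc m₂ ^ 2 ≤ max m₂ 1 ^ 2 := pow_le_pow_left₀ hm0 (le_max_left _ _) 2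
    _ = κ * (max m₂ 1 ^ 2 / κ) := by field_simp

theorem ofReal_two_pow_div_le {κ : ℝ} (hκ : 0 < κ) :
    ENNReal.ofReal (2 ^ d) / ENNReal.ofReal (2 ^ d / κ) ≤ ENNReal.ofReal κ := by
  rw [← ENNReal.ofReal_div_of_pos (by positivity)]
  refine ENNReal.ofReal_le_ofReal (le_of_eq ?_)
  field_simp

theorem measure_norm_snd_gt_le [IsProbabilityMeasure q₀] (ht : 0 < t) {κ : ℝ} (hκ : 0 < κ)
    (hκ1 : κ ≤ 1) :
    sampleLaw q₀ t {p | 2 * noiseLevel t * Real.sqrt (Real.log (2 ^ d / κ)) < ‖p.2‖}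
      ≤ ENNReal.ofReal κ := by
  have hs := noiseLevel_pos ht
  have hℓ : 0 ≤ Real.log (2 ^ d / κ) := by
    refine Real.log_nonneg ?_
    rw [le_div_iff₀ hκ, one_mul]
    exact hκ1.trans (one_le_pow₀ one_le_two)
  have hsub : {p : EuclideanSpace ℝ (Fin d) × EuclideanSpace ℝ (Fin d) |
      2 * noiseLevel t * Real.sqrt (Real.log (2 ^ d / κ)) < ‖p.2‖} ⊆
      {p | ENNReal.ofReal (2 ^ d / κ) ≤
        ENNReal.ofReal (Real.exp (‖p.2‖ ^ 2 / (4 * noiseLevel t ^ 2)))} := by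
    intro p hp
    refine ENNReal.ofReal_le_ofReal ?_
    rw [← Real.log_le_iff_le_exp (by positivity), le_div_iff₀ (by positivity)]
    calc Real.log (2 ^ d / κ) * (4 * noiseLevel t ^ 2)
        = (2 * noiseLevel t * Real.sqrt (Real.log (2 ^ d / κ))) ^ 2 := by
          rw [mul_pow, Real.sq_sqrt hℓ]; ring
      _ ≤ ‖p.2‖ ^ 2 := pow_le_pow_left₀ (by positivity) (le_of_lt hp) 2
  refine (measure_mono hsub).trans ((meas_ge_le_lintegral_div
    (Measurable.aemeasurable (by fun_prop)) (by simpa using (by positivity : 0 < 2 ^ d / κ))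
    ENNReal.ofReal_ne_top).trans ?_)
  rw [lintegral_sampleLaw_snd (F := fun z => ENNReal.ofReal
    (Real.exp (‖z‖ ^ 2 / (4 * noiseLevel t ^ 2)))) (by fun_prop)]
  exact (ENNReal.div_le_div_right (lintegral_exp_noise_le ht) _).trans (ofReal_two_pow_div_le hκ)

theorem measure_compl_typicalSet_le [IsProbabilityMeasure q₀] (ht : 0 < t) {κ : ℝ} (hκ : 0 < κ) :
    sampleLaw q₀ t {p | noised t p ∉ typicalSet q₀ t (2 ^ d / κ)} ≤ ENNReal.ofReal κ := by
  have hsub : {p | noised t p ∉ typicalSet q₀ t (2 ^ d / κ)} ⊆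
      {p | ENNReal.ofReal (2 ^ d / κ) ≤ posteriorMoment q₀ t (noised t p)} := by
    intro p hp
    simp only [typicalSet, Set.mem_ofPred_eq, not_le] at hp ⊢
    exact hp.le
  have hm : Measurable fun p => posteriorMoment q₀ t (noised t p) :=
    measurable_posteriorMoment.comp measurable_noised
  refine (measure_mono hsub).trans ((meas_ge_le_lintegral_div hm.aemeasurable
    (by simpa using (by positivity : 0 < 2 ^ d / κ)) ENNReal.ofReal_ne_top).trans ?_)
  have h1 : ∫⁻ p, posteriorMoment q₀ t (noised t p) ∂(sampleLaw q₀ t)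
      = ∫⁻ z, ENNReal.ofReal (Real.exp (‖z‖ ^ 2 / (4 * noiseLevel t ^ 2))) ∂(noise d t) := by
    rw [← lintegral_map (measurable_posteriorMoment (q₀ := q₀)) measurable_noised,
      ← lintegral_sampleLaw_snd (q₀ := q₀) (F := fun z => ENNReal.ofReal
        (Real.exp (‖z‖ ^ 2 / (4 * noiseLevel t ^ 2)))) (by fun_prop),
      lintegral_sampleLaw_eq_posterior ht (by fun_prop)]
    rfl
  rw [h1]
  exact (ENNReal.div_le_div_right (lintegral_exp_noise_le ht) _).trans (ofReal_two_pow_div_le hκ)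

/-- The samples with a bounded clean point, bounded noise and a typical noised point; each of the
three requirements fails with probability at most `κ`. -/
def typicalSamples (q₀ : Measure (EuclideanSpace ℝ (Fin d))) (t m₂ κ : ℝ) :
    Set (EuclideanSpace ℝ (Fin d) × EuclideanSpace ℝ (Fin d)) :=
  {p | ‖p.1‖ ≤ max m₂ 1 / Real.sqrt κ ∧
    ‖p.2‖ ≤ 2 * noiseLevel t * Real.sqrt (Real.log (2 ^ d / κ)) ∧
    noised t p ∈ typicalSet q₀ t (2 ^ d / κ)}

theorem measurableSet_typicalSamples [IsProbabilityMeasure q₀] {m₂ κ : ℝ} :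
    MeasurableSet (typicalSamples q₀ t m₂ κ) := by
  have h1 : MeasurableSet {p : EuclideanSpace ℝ (Fin d) × EuclideanSpace ℝ (Fin d) |
      ‖p.1‖ ≤ max m₂ 1 / Real.sqrt κ} := measurableSet_le (by fun_prop) measurable_const
  have h2 : MeasurableSet {p : EuclideanSpace ℝ (Fin d) × EuclideanSpace ℝ (Fin d) |
      ‖p.2‖ ≤ 2 * noiseLevel t * Real.sqrt (Real.log (2 ^ d / κ))} :=
    measurableSet_le (by fun_prop) measurable_const
  exact h1.inter (h2.inter
    (measurable_noised (measurableSet_typicalSet (q₀ := q₀) (B := 2 ^ d / κ))))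

theorem measure_compl_typicalSamples_le [IsProbabilityMeasure q₀] (ht : 0 < t) {m₂ κ : ℝ}
    (hκ : 0 < κ) (hκ1 : κ ≤ 1)
    (hint : Integrable (fun y => ‖y‖ ^ 2) q₀) (hm₂ : ∫ y, ‖y‖ ^ 2 ∂q₀ = m₂ ^ 2) (hm0 : 0 ≤ m₂) :
    sampleLaw q₀ t (typicalSamples q₀ t m₂ κ)ᶜ ≤ ENNReal.ofReal (3 * κ) := by
  have hsub : (typicalSamples q₀ t m₂ κ)ᶜ ⊆
      ({p | max m₂ 1 / Real.sqrt κ < ‖p.1‖} ∪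
        {p | 2 * noiseLevel t * Real.sqrt (Real.log (2 ^ d / κ)) < ‖p.2‖}) ∪
        {p | noised t p ∉ typicalSet q₀ t (2 ^ d / κ)} := by
    intro p hp
    by_contra hcon
    simp only [Set.mem_union, Set.mem_ofPred_eq, not_or, not_lt, not_not] at hcon
    exact hp ⟨hcon.1.1, hcon.1.2, hcon.2⟩
  refine (measure_mono hsub).trans ((measure_union_le _ _).trans
    ((add_le_add_left (measure_union_le _ _) _).trans ?_))
  have : ENNReal.ofReal (3 * κ) = ENNReal.ofReal κ + ENNReal.ofReal κ + ENNReal.ofReal κ := by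
    rw [← ENNReal.ofReal_add hκ.le hκ.le, ← ENNReal.ofReal_add (by positivity) hκ.le]
    congr 1; ring
  rw [this]
  exact add_le_add (add_le_add (measure_norm_fst_gt_le hκ hint hm₂ hm0)
    (measure_norm_snd_gt_le ht hκ hκ1)) (measure_compl_typicalSet_le ht hκ)

end

section

variable {d m : ℕ} {t : ℝ} {q₀ : Measure (EuclideanSpace ℝ (Fin d))}

/-! ### Excess empirical loss -/

/-- The loss of `f` on a sample minus the loss of the true score. -/
def excessLoss (q₀ : Measure (EuclideanSpace ℝ (Fin d))) (t : ℝ)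
    (f : EuclideanSpace ℝ (Fin d) → EuclideanSpace ℝ (Fin d))
    (p : EuclideanSpace ℝ (Fin d) × EuclideanSpace ℝ (Fin d)) : ℝ :=
  ‖f (noised t p) - target t p.2‖ ^ 2 - ‖score q₀ t (noised t p) - target t p.2‖ ^ 2

theorem excessLoss_eq (f : EuclideanSpace ℝ (Fin d) → EuclideanSpace ℝ (Fin d))
    (p : EuclideanSpace ℝ (Fin d) × EuclideanSpace ℝ (Fin d)) :
    excessLoss q₀ t f p = ‖f (noised t p) - score q₀ t (noised t p)‖ ^ 2
      - 2 * inner ℝ (f (noised t p) - score q₀ t (noised t p)) (residual q₀ t p) := by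
  have h1 : f (noised t p) - target t p.2
      = (f (noised t p) - score q₀ t (noised t p)) - residual q₀ t p := by
    unfold residual; abel
  have h2 : score q₀ t (noised t p) - target t p.2 = -residual q₀ t p := by
    unfold residual; abel
  rw [excessLoss, h1, h2, norm_neg, norm_sub_sq_real]
  ring

/-- The empirical excess loss of a fixed function is at most `3/2` times its empirical squared
error, up to an exponentially small probability. -/
theorem measure_sum_excessLoss_ge_le [IsProbabilityMeasure q₀] (ht : 0 < t) {B a : ℝ}
    (hB : 2 ≤ B) (ha : a * (128 * Real.log B) = noiseLevel t ^ 2)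
    {f : EuclideanSpace ℝ (Fin d) → EuclideanSpace ℝ (Fin d)} (hf : Measurable f) (u : ℝ) :
    Measure.pi (fun _ : Fin m => sampleLaw q₀ t)
        {ω | (∀ i, noised t (ω i) ∈ typicalSet q₀ t B) ∧
          u ≤ ∑ i, a * (excessLoss q₀ t f (ω i)
            - 3 / 2 * ‖f (noised t (ω i)) - score q₀ t (noised t (ω i))‖ ^ 2)}
      ≤ ENNReal.ofReal (Real.exp (-u)) := by
  have hg : Measurable fun x => f x - score q₀ t x := hf.sub measurable_score
  have hw : Measurable fun x => -(a / 2) * ‖f x - score q₀ t x‖ ^ 2 :=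
    (hg.norm.pow_const 2).const_mul _
  have key := measure_sum_residual_ge_le (m := m) (q₀ := q₀) ht hB hw (hg.const_smul (-(2 * a))) u
  -- the choice of `a` makes the sub-Gaussian bound cancel the quadratic term exactly
  have hone : ∀ x, -(a / 2) * ‖f x - score q₀ t x‖ ^ 2 +
      16 * ‖(-(2 * a)) • (f x - score q₀ t x)‖ ^ 2 * Real.log B / noiseLevel t ^ 2 = 0 := by
    intro x
    have hs := noiseLevel_pos ht
    rw [norm_smul, mul_pow, Real.norm_eq_abs, sq_abs]
    field_simp
    rw [← ha]; ring
  simp only [Pi.smul_apply] at key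
  simp_rw [hone] at key
  refine le_trans (measure_mono ?_) (key.trans (le_of_eq (by simp)))
  rintro ω ⟨h1, h2⟩
  refine ⟨h1, h2.trans (le_of_eq (Finset.sum_congr rfl fun i _ => ?_))⟩
  rw [excessLoss_eq, inner_smul_left]
  simp only [conj_trivial]
  ring

/-- A fixed function with a large quantile error has a large empirical excess loss, up to an
exponentially small probability. -/
theorem measure_sum_excessLoss_le_le [IsProbabilityMeasure q₀] (ht : 0 < t) {B a ρ p T : ℝ}
    (hB : 2 ≤ B) (ha : a * (128 * Real.log B) = noiseLevel t ^ 2) (ha0 : 0 ≤ a) (hρ : 0 ≤ ρ)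
    (hr : a * ρ ^ 2 / 2 ≤ 1)
    {f : EuclideanSpace ℝ (Fin d) → EuclideanSpace ℝ (Fin d)} (hf : Measurable f)
    (hbad : ENNReal.ofReal p ≤ smoothed q₀ t {x | ρ < ‖f x - score q₀ t x‖}) :
    Measure.pi (fun _ : Fin m => sampleLaw q₀ t)
        {ω | (∀ i, noised t (ω i) ∈ typicalSet q₀ t B) ∧ ∑ i, excessLoss q₀ t f (ω i) ≤ T}
      ≤ ENNReal.ofReal (Real.exp (a * T - m * (p * (a * ρ ^ 2 / 2) / 2))) := by
  have hg : Measurable fun x => f x - score q₀ t x := hf.sub measurable_score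
  have hw : Measurable fun x => -a * ‖f x - score q₀ t x‖ ^ 2 :=
    (hg.norm.pow_const 2).const_mul _
  have key := measure_sum_residual_ge_le (m := m) (q₀ := q₀) ht hB hw (hg.const_smul (2 * a))
    (-(a * T))
  -- half of the quadratic term survives the sub-Gaussian bound
  have hhalf : ∀ x, -a * ‖f x - score q₀ t x‖ ^ 2 +
      16 * ‖(2 * a) • (f x - score q₀ t x)‖ ^ 2 * Real.log B / noiseLevel t ^ 2
        = -(a * ‖f x - score q₀ t x‖ ^ 2 / 2) := by
    intro x
    have hs := noiseLevel_pos ht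
    rw [norm_smul, mul_pow, Real.norm_eq_abs, sq_abs]
    field_simp
    rw [← ha]; ring
  simp only [Pi.smul_apply] at key
  simp_rw [hhalf] at key
  refine le_trans (measure_mono ?_) (key.trans ?_)
  · rintro ω ⟨h1, h2⟩
    refine ⟨h1, ?_⟩
    have h3 : ∑ i, (-a * ‖f (noised t (ω i)) - score q₀ t (noised t (ω i))‖ ^ 2
        + inner ℝ ((2 * a) • (f (noised t (ω i)) - score q₀ t (noised t (ω i))))
          (residual q₀ t (ω i))) = -(a * ∑ i, excessLoss q₀ t f (ω i)) := by
      rw [Finset.mul_sum, ← Finset.sum_neg_distrib]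
      refine Finset.sum_congr rfl fun i _ => ?_
      rw [excessLoss_eq, inner_smul_left]
      simp only [conj_trivial]
      ring
    rw [h3]
    exact neg_le_neg (mul_le_mul_of_nonneg_left h2 ha0)
  · have hlap := lintegral_exp_neg_le (μ := smoothed q₀ t) (p := p)
      (φ := fun x => a * ‖f x - score q₀ t x‖ ^ 2 / 2)
      (((hg.norm.pow_const 2).const_mul a).div_const 2) (fun x => by positivity)
      (by positivity) hr (hbad.trans (measure_mono fun x hx => by
        have hx' : ρ < ‖f x - score q₀ t x‖ := hx
        have : ρ ^ 2 ≤ ‖f x - score q₀ t x‖ ^ 2 := pow_le_pow_left₀ hρ hx'.le 2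
        simp only [Set.mem_ofPred_eq]
        gcongr))
    calc _ ≤ ENNReal.ofReal (Real.exp (-(p * (a * ρ ^ 2 / 2) / 2))) ^ m *
          ENNReal.ofReal (Real.exp (- -(a * T))) := by gcongr
      _ = _ := by
        rw [← ENNReal.ofReal_pow (Real.exp_pos _).le, ← Real.exp_nat_mul,
          ← ENNReal.ofReal_mul (Real.exp_pos _).le, ← Real.exp_add]
        congr 2
        ring

/-! ### Discretization of the weights -/

theorem abs_norm_sub_sq_sub_le {E : Type*} [NormedAddCommGroup E] {u v w : E} {Δ M : ℝ}
    (hΔ : ‖u - v‖ ≤ Δ) (hM : ‖u‖ + ‖v‖ + 2 * ‖w‖ ≤ M) :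
    |‖u - w‖ ^ 2 - ‖v - w‖ ^ 2| ≤ Δ * M := by
  have h1 : ‖u - w‖ ^ 2 - ‖v - w‖ ^ 2 = (‖u - w‖ - ‖v - w‖) * (‖u - w‖ + ‖v - w‖) := by ring
  have h2 : |‖u - w‖ - ‖v - w‖| ≤ Δ := by
    refine (abs_norm_sub_norm_le _ _).trans ?_
    rwa [sub_sub_sub_cancel_right]
  have h3 : ‖u - w‖ + ‖v - w‖ ≤ M := by linarith [norm_sub_le u w, norm_sub_le v w]
  rw [h1, abs_mul, abs_of_nonneg (by positivity : 0 ≤ ‖u - w‖ + ‖v - w‖)]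
  exact mul_le_mul h2 h3 (by positivity) ((norm_nonneg _).trans hΔ)

variable {biased : Bool} {hs : List ℕ}

/-- At the resolution `η` of the grid, nearby weights give nearby functions and nearby losses on
inputs of norm at most `R`. -/
theorem norm_net_sub_le_of_resolution {Θ ε δ R η : ℝ} (hΘ : 1 < Θ) (hε0 : 0 < ε) (hε1 : ε ≤ 1)
    (hδ0 : 0 < δ) (hδ1 : δ < 1) (hR : 0 ≤ R)
    (hη : η * (768 * (3 * Θ) ^ (2 * depth hs + 1) * (R + 1) ^ 2) = δ * ε ^ 2)
    {θ θ' : Params biased d hs d} (hθ : ‖θ‖ ≤ Θ) (hθ' : ‖θ'‖ ≤ Θ) (hd : ‖θ - θ'‖ ≤ η)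
    {x : EuclideanSpace ℝ (Fin d)} (hx : ‖x‖ ≤ R) :
    ‖net θ x - net θ' x‖ ≤ ε / 2 ∧
      ∀ {s : ℝ} {w : EuclideanSpace ℝ (Fin d)}, 0 < s → s ≤ 1 → ‖w‖ ≤ R / s →
        |‖net θ x - w‖ ^ 2 - ‖net θ' x - w‖ ^ 2| ≤ δ * ε ^ 2 / (128 * s ^ 2) := by
  have hη0 : 0 ≤ η := (norm_nonneg _).trans hd
  set A := (3 * Θ) ^ depth hs with hA
  have hA1 : 1 ≤ A := one_le_pow₀ (by linarith)
  have hA2 : (3 * Θ) ^ (2 * depth hs + 1) = A ^ 2 * (3 * Θ) := by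
    rw [hA, ← pow_mul, mul_comm (depth hs) 2, pow_succ]
  rw [hA2] at hη
  set Q := R + 1 with hQ
  have hQ1 : 1 ≤ Q := by linarith
  have hdiff : ‖net θ x - net θ' x‖ ≤ A * η * Q := by
    refine (norm_net_sub_le hΘ.le hθ hθ' hd x).trans ?_
    rw [mul_assoc]
    gcongr
    linarith
  have hden : 0 < A * Θ * Q := by positivity
  have hΔ : A * η * Q = δ * ε ^ 2 / (2304 * (A * Θ * Q)) := by
    rw [eq_div_iff (by positivity), ← hη]; ring
  have hAΘQ : 1 ≤ A * Θ * Q := one_le_mul_of_one_le_of_one_le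
    (one_le_mul_of_one_le_of_one_le hA1 hΘ.le) hQ1
  refine ⟨hdiff.trans ?_, ?_⟩
  · rw [hΔ, div_le_iff₀ (by positivity)]
    have : δ * ε ^ 2 ≤ ε := by nlinarith
    nlinarith
  · intro s w hs0 hs1 hw
    have hn1 : ‖net θ x‖ ≤ A * Θ * Q := by
      refine (norm_net_le hΘ.le hθ x).trans ?_
      rw [mul_assoc]; gcongr; linarith
    have hn2 : ‖net θ' x‖ ≤ A * Θ * Q := by
      refine (norm_net_le hΘ.le hθ' x).trans ?_
      rw [mul_assoc]; gcongr; linarith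
    have hdiv : A * Θ * Q ≤ A * Θ * Q / s := le_div_self hden.le hs0 hs1
    have hw' : ‖w‖ ≤ A * Θ * Q / s := by
      refine hw.trans ?_
      gcongr
      have : 1 * Q ≤ A * Θ * Q := by
        gcongr; exact one_le_mul_of_one_le_of_one_le hA1 hΘ.le
      linarith
    refine (abs_norm_sub_sq_sub_le hdiff (M := 4 * (A * Θ * Q / s)) (by linarith)).trans ?_
    rw [hΔ]
    have e : δ * ε ^ 2 / (2304 * (A * Θ * Q)) * (4 * (A * Θ * Q / s)) = δ * ε ^ 2 / (576 * s) := by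
      field_simp; norm_num
    rw [e]
    refine div_le_div_of_nonneg_left (by positivity) (by positivity) ?_
    nlinarith

theorem norm_noised_le {m₂ κ : ℝ} (ht : 0 < t)
    {p : EuclideanSpace ℝ (Fin d) × EuclideanSpace ℝ (Fin d)}
    (hp : p ∈ typicalSamples q₀ t m₂ κ) :
    ‖noised t p‖ ≤ max m₂ 1 / Real.sqrt κ + 2 * Real.sqrt (Real.log (2 ^ d / κ)) := by
  obtain ⟨h1, h2, _⟩ := hp
  have he : Real.exp (-t) ≤ 1 := Real.exp_le_one_iff.2 (by linarith)
  have h3 : ‖Real.exp (-t) • p.1‖ ≤ ‖p.1‖ := by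
    rw [norm_smul, Real.norm_of_nonneg (Real.exp_pos _).le]
    exact mul_le_of_le_one_left (norm_nonneg _) he
  have h4 : 2 * noiseLevel t * Real.sqrt (Real.log (2 ^ d / κ))
      ≤ 2 * Real.sqrt (Real.log (2 ^ d / κ)) := by
    have := noiseLevel_le_one (t := t)
    gcongr
    linarith
  unfold noised
  linarith [norm_add_le (Real.exp (-t) • p.1) p.2]

theorem norm_target_le {m₂ κ : ℝ} (ht : 0 < t)
    {p : EuclideanSpace ℝ (Fin d) × EuclideanSpace ℝ (Fin d)}
    (hp : p ∈ typicalSamples q₀ t m₂ κ) :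
    ‖target t p.2‖ ≤ 2 * Real.sqrt (Real.log (2 ^ d / κ)) / noiseLevel t := by
  obtain ⟨_, h2, _⟩ := hp
  have hs := noiseLevel_pos ht
  rw [target, norm_smul, norm_neg, Real.norm_of_nonneg (by positivity), le_div_iff₀ hs]
  calc 1 / noiseLevel t ^ 2 * ‖p.2‖ * noiseLevel t = ‖p.2‖ / noiseLevel t := by field_simp
    _ ≤ _ := by rw [div_le_iff₀ hs]; linarith

/-- A function within `r / 2` of one with large quantile error, on a set of large probability, has
large quantile error too. -/
theorem le_measure_of_not_quantileErrorLE {μ : Measure (EuclideanSpace ℝ (Fin d))}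
    [IsProbabilityMeasure μ] {δ r : ℝ}
    {f f' g : EuclideanSpace ℝ (Fin d) → EuclideanSpace ℝ (Fin d)} (hf : Measurable f)
    (hg : Measurable g) (hδ0 : 0 < δ) (hbad : ¬ QuantileErrorLE μ δ f g r)
    {S : Set (EuclideanSpace ℝ (Fin d))}
    (hS : μ Sᶜ ≤ ENNReal.ofReal (δ / 2)) (hff : ∀ x ∈ S, ‖f x - f' x‖ ≤ r / 2) :
    ENNReal.ofReal (δ / 2) ≤ μ {x | r / 2 < ‖f' x - g x‖} := by
  have hmeas : MeasurableSet {x | ‖f x - g x‖ ≤ r} :=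
    measurableSet_le (hf.sub hg).norm measurable_const
  have h1 : ENNReal.ofReal δ ≤ μ {x | ‖f x - g x‖ ≤ r}ᶜ := by
    rw [prob_compl_eq_one_sub hmeas]
    refine ENNReal.le_sub_of_add_le_left (measure_ne_top _ _) ?_
    have hlt : μ {x | ‖f x - g x‖ ≤ r} ≤ ENNReal.ofReal (1 - δ) := (not_le.1 hbad).le
    have hpos : 0 < 1 - δ := by
      by_contra hcon
      exact hbad (by rw [QuantileErrorLE, ENNReal.ofReal_of_nonpos (not_lt.1 hcon)]; exact zero_le)
    calc _ ≤ ENNReal.ofReal (1 - δ) + ENNReal.ofReal δ := by gcongr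
      _ = 1 := by rw [← ENNReal.ofReal_add hpos.le hδ0.le]; simp
  have h2 : {x | ‖f x - g x‖ ≤ r}ᶜ ⊆ {x | r / 2 < ‖f' x - g x‖} ∪ Sᶜ := by
    intro x hx
    by_cases hxS : x ∈ S
    · left
      have hx' : r < ‖f x - g x‖ := by simpa using hx
      have h3 := norm_add_le (f x - f' x) (f' x - g x)
      rw [sub_add_sub_cancel] at h3
      simp only [Set.mem_ofPred_eq]
      linarith [hff x hxS]
    · exact Or.inr hxS
  have h3 := h1.trans ((measure_mono h2).trans (measure_union_le _ _))
  have h4 : ENNReal.ofReal δ = ENNReal.ofReal (δ / 2) + ENNReal.ofReal (δ / 2) := by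
    rw [← ENNReal.ofReal_add (by positivity) (by positivity)]; congr 1; ring
  rw [h4] at h3
  have h5 := h3.trans (add_le_add_right hS _)
  exact (ENNReal.add_le_add_iff_right ENNReal.ofReal_ne_top).1 h5

end

section

variable {d m : ℕ} {t : ℝ} {q₀ : Measure (EuclideanSpace ℝ (Fin d))}
variable {biased : Bool} {hs : List ℕ}

/-! ### Failure probability of empirical minimization -/

theorem sum_excessLoss_sub {f f' : EuclideanSpace ℝ (Fin d) → EuclideanSpace ℝ (Fin d)}
    (ω : Fin m → EuclideanSpace ℝ (Fin d) × EuclideanSpace ℝ (Fin d)) :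
    ∑ i, excessLoss q₀ t f (ω i) - ∑ i, excessLoss q₀ t f' (ω i)
      = ∑ i, (‖f (noised t (ω i)) - target t (ω i).2‖ ^ 2
        - ‖f' (noised t (ω i)) - target t (ω i).2‖ ^ 2) := by
  rw [← Finset.sum_sub_distrib]
  refine Finset.sum_congr rfl fun i _ => ?_
  unfold excessLoss
  ring

theorem sum_excessLoss_le_of_isEmpiricalMinimizer (hm : 0 < m) {Θ : ℝ}
    {ω : Fin m → EuclideanSpace ℝ (Fin d) × EuclideanSpace ℝ (Fin d)}
    {θ θ' : Params biased d hs d} (hθ : IsEmpiricalMinimizer t Θ ω θ) (hθ' : ‖θ'‖ ≤ Θ) :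
    ∑ i, excessLoss q₀ t (net θ) (ω i) ≤ ∑ i, excessLoss q₀ t (net θ') (ω i) := by
  have h := hθ.2 θ' hθ'
  unfold empiricalLoss at h
  have hm' : (0 : ℝ) < 1 / m := by positivity
  have h2 := le_of_mul_le_mul_left h hm'
  rw [← sub_nonpos, sum_excessLoss_sub, Finset.sum_sub_distrib, sub_nonpos]
  exact h2

/-- The failure event is covered by four events: some sample is atypical; `θ*` has a large empirical
squared error; `θ*` has a large empirical excess loss compared with its squared error; some grid
point with large quantile error has a small empirical excess loss. Here `κ` is the failure
probability of each requirement on a typical sample, `ℓ` the logarithm of the bound on its posterior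
moment, `R` the radius that contains its noised point, and `η` the resolution of the grid. -/
theorem measure_bad_minimizer_le [IsProbabilityMeasure q₀] {m₂ Θ ε δs δ κ ℓ R η : ℝ}
    (hd : 0 < d) (hm : 0 < m) (ht : 0 < t) (hm₂0 : 0 ≤ m₂)
    (hint : Integrable (fun y => ‖y‖ ^ 2) q₀) (hm₂ : ∫ y, ‖y‖ ^ 2 ∂q₀ = m₂ ^ 2)
    (hΘ : 1 < Θ) (hε0 : 0 < ε) (hε1 : ε ≤ 1) (hδs0 : 0 < δs) (hδs1 : δs < 1) (hδ0 : 0 < δ)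
    (hδ1 : δ < 1)
    (hκ : κ = δ / (15 * m)) (hℓ : ℓ = Real.log (2 ^ d / κ))
    (hR : R = max m₂ 1 / Real.sqrt κ + 2 * Real.sqrt ℓ)
    (hη : η * (768 * (3 * Θ) ^ (2 * depth hs + 1) * (R + 1) ^ 2) = δs * ε ^ 2)
    (hmδ : 1 ≤ m * δs) (hP : 0 < numParams biased d hs d)
    (hcard : (3 * Θ * numParams biased d hs d / η) ^ numParams biased d hs d *
      Real.exp (-(m * δs * ε ^ 2 / (8192 * ℓ))) ≤ δ / 5)
    (hlog : 32768 * ℓ * Real.log (5 / δ) ≤ m * δs * ε ^ 2)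
    {θs : Params biased d hs d} (hθs : ‖θs‖ ≤ Θ)
    (herr : ∫⁻ x, ENNReal.ofReal (‖net θs x - score q₀ t x‖ ^ 2) ∂(smoothed q₀ t)
      ≤ ENNReal.ofReal (δs * δ * ε ^ 2 / (2000 * noiseLevel t ^ 2))) :
    Measure.pi (fun _ : Fin m => sampleLaw q₀ t)
        {ω | ∃ θhat : Params biased d hs d, IsEmpiricalMinimizer t Θ ω θhat ∧
          ¬ QuantileErrorLE (smoothed q₀ t) δs (net θhat) (score q₀ t) (ε / noiseLevel t)}
      ≤ ENNReal.ofReal δ := by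
  classical
  have hσ := noiseLevel_pos ht
  have hσ1 := noiseLevel_le_one (t := t)
  set σ := noiseLevel t
  have hm' : (1 : ℝ) ≤ m := by exact_mod_cast hm
  have hκ0 : 0 < κ := by rw [hκ]; positivity
  have hκ1 : κ ≤ 1 := by
    rw [hκ, div_le_one (by positivity)]; linarith
  set B : ℝ := 2 ^ d / κ with hB
  have hB2 : 2 ≤ B := by
    rw [hB, le_div_iff₀ hκ0]
    have : (2 : ℝ) ^ 1 ≤ 2 ^ d := pow_le_pow_right₀ one_le_two hd
    linarith
  have hℓ0 : 1 / 2 ≤ ℓ := by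
    have := Real.log_le_log (by norm_num) hB2
    rw [hℓ]
    linarith [Real.log_two_gt_d9]
  have hℓpos : 0 < ℓ := by linarith
  have hR0 : 0 ≤ R := by
    have : 0 < max m₂ 1 := lt_max_of_lt_right one_pos
    rw [hR]; positivity
  have hη0 : 0 < η := by
    refine pos_of_mul_pos_left (b := 768 * (3 * Θ) ^ (2 * depth hs + 1) * (R + 1) ^ 2) ?_
      (by positivity)
    rw [hη]; positivity
  have hηΘ : η ≤ Θ := by
    have h1 : (1 : ℝ) ≤ (3 * Θ) ^ (2 * depth hs + 1) := one_le_pow₀ (by linarith)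
    have h2 : (1 : ℝ) ≤ (R + 1) ^ 2 := one_le_pow₀ (by linarith)
    have h3 : 1 ≤ 768 * (3 * Θ) ^ (2 * depth hs + 1) * (R + 1) ^ 2 :=
      one_le_mul_of_one_le_of_one_le (by linarith) h2
    have h4 : η ≤ δs * ε ^ 2 := by rw [← hη]; exact le_mul_of_one_le_right hη0.le h3
    have h5 : δs * ε ^ 2 ≤ 1 := mul_le_one₀ hδs1.le (by positivity) (pow_le_one₀ hε0.le hε1)
    linarith
  obtain ⟨N, hN, hNcov⟩ := exists_finset_net (ι := ParamIndex biased d hs d) (by linarith)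
    hη0 hηΘ hP
  change (N.card : ℝ) ≤ (3 * Θ * numParams biased d hs d / η) ^ numParams biased d hs d at hN
  -- the parameter of the exponential moments and the threshold for the excess loss
  set a : ℝ := σ ^ 2 / (128 * ℓ) with ha_def
  have ha0 : 0 < a := by positivity
  have ha : a * (128 * Real.log B) = σ ^ 2 := by
    rw [← hℓ, ha_def]; field_simp
  set T : ℝ := m * δs * ε ^ 2 / (64 * σ ^ 2) with hT
  have hTpos : 0 < T := by positivity
  -- the level that the squared error of `θ*` exceeds with probability at most `δ / 5`
  set u : ℝ := m * δs * ε ^ 2 / (400 * σ ^ 2) with hu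
  have hupos : 0 < u := by positivity
  set typ := typicalSamples q₀ t m₂ κ with htyp
  let sqErr : EuclideanSpace ℝ (Fin d) × EuclideanSpace ℝ (Fin d) → ℝ := fun p =>
    ‖net θs (noised t p) - score q₀ t (noised t p)‖ ^ 2
  -- the four events: atypical sample, large squared error of `θ*`, large noise term of `θ*`, and
  -- small excess loss of a given grid point
  let Eatyp : Set (Fin m → EuclideanSpace ℝ (Fin d) × EuclideanSpace ℝ (Fin d)) :=
    {ω | ∃ i, ω i ∈ typᶜ}
  let Eerr : Set (Fin m → EuclideanSpace ℝ (Fin d) × EuclideanSpace ℝ (Fin d)) :=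
    {ω | u ≤ ∑ i, sqErr (ω i)}
  let Estar : Set (Fin m → EuclideanSpace ℝ (Fin d) × EuclideanSpace ℝ (Fin d)) :=
    {ω | (∀ i, noised t (ω i) ∈ typicalSet q₀ t B) ∧
      Real.log (5 / δ) ≤ ∑ i, a * (excessLoss q₀ t (net θs) (ω i)
        - 3 / 2 * ‖net θs (noised t (ω i)) - score q₀ t (noised t (ω i))‖ ^ 2)}
  let Egrid : Params biased d hs d →
      Set (Fin m → EuclideanSpace ℝ (Fin d) × EuclideanSpace ℝ (Fin d)) := fun θ =>
    {ω | (∀ i, noised t (ω i) ∈ typicalSet q₀ t B) ∧ ∑ i, excessLoss q₀ t (net θ) (ω i) ≤ T}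
  let N' := N.filter fun θ =>
    ENNReal.ofReal (δs / 2) ≤ smoothed q₀ t {x | ε / σ / 2 < ‖net θ x - score q₀ t x‖}
  have hcover : {ω | ∃ θhat : Params biased d hs d, IsEmpiricalMinimizer t Θ ω θhat ∧
      ¬ QuantileErrorLE (smoothed q₀ t) δs (net θhat) (score q₀ t) (ε / σ)}
      ⊆ ((Eatyp ∪ Eerr) ∪ Estar) ∪ ⋃ θ ∈ N', Egrid θ := by
    rintro ω ⟨θ, hmin, hbad⟩
    by_contra hcon
    simp only [Set.mem_union, not_or] at hcon
    obtain ⟨⟨⟨h1, h2⟩, h3⟩, h4⟩ := hcon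
    have htypω : ∀ i, ω i ∈ typ := by
      intro i
      by_contra hi
      exact h1 ⟨i, hi⟩
    have htypx : ∀ i, noised t (ω i) ∈ typicalSet q₀ t B := fun i => (htypω i).2.2
    have h2' : ∑ i, sqErr (ω i) < u := not_le.1 h2
    have h3' : ∑ i, a * (excessLoss q₀ t (net θs) (ω i)
        - 3 / 2 * ‖net θs (noised t (ω i)) - score q₀ t (noised t (ω i))‖ ^ 2)
        < Real.log (5 / δ) := by
      by_contra hc
      exact h3 ⟨htypx, not_lt.1 hc⟩
    -- the excess loss of `θ*` is small
    have hstar : ∑ i, excessLoss q₀ t (net θs) (ω i) ≤ T / 2 := by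
      rw [← Finset.mul_sum, Finset.sum_sub_distrib, ← Finset.mul_sum] at h3'
      have h5 : ∑ i, excessLoss q₀ t (net θs) (ω i) - 3 / 2 * ∑ i, sqErr (ω i)
          ≤ Real.log (5 / δ) / a := by
        rw [le_div_iff₀ ha0, mul_comm]; exact h3'.le
      have h6 : Real.log (5 / δ) / a ≤ T / 4 := by
        have e : Real.log (5 / δ) / a = 32768 * ℓ * Real.log (5 / δ) / (256 * σ ^ 2) := by
          rw [ha_def]; field_simp; ring
        have e' : T / 4 = m * δs * ε ^ 2 / (256 * σ ^ 2) := by rw [hT]; field_simp; norm_num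
        rw [e, e']
        gcongr
      have h7 : u = T * (64 / 400) := by rw [hu, hT]; field_simp
      linarith
    -- pass from the minimizer to a grid point
    obtain ⟨θ', hθ'N, hθ', hθθ'⟩ := hNcov θ hmin.1
    have hball : ∀ x : EuclideanSpace ℝ (Fin d), ‖x‖ ≤ R → _ := fun x hx =>
      norm_net_sub_le_of_resolution hΘ hε0 hε1 hδs0 hδs1 hR0 hη hmin.1 hθ' hθθ' hx
    have hθ'bad : θ' ∈ N' := by
      refine Finset.mem_filter.2 ⟨hθ'N, ?_⟩
      refine le_measure_of_not_quantileErrorLE (continuous_net θ).measurable measurable_score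
        hδs0 hbad (S := {x | ‖x‖ ≤ R}) ?_ ?_
      · have hS : MeasurableSet {x : EuclideanSpace ℝ (Fin d) | ‖x‖ ≤ R} :=
          measurableSet_le measurable_norm measurable_const
        rw [smoothed, Measure.map_apply measurable_noised hS.compl]
        refine (measure_mono (t := typᶜ) ?_).trans
          ((measure_compl_typicalSamples_le ht hκ0 hκ1 hint hm₂ hm₂0).trans ?_)
        · intro p hp hp'
          refine hp ?_
          have := norm_noised_le ht hp'
          rw [← hB, ← hℓ, ← hR] at this
          exact this
        · refine ENNReal.ofReal_le_ofReal ?_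
          have : 1 / (m : ℝ) ≤ δs := by rw [div_le_iff₀ (by positivity)]; linarith
          have e : 3 * κ = δ * (1 / m) / 5 := by rw [hκ]; field_simp; norm_num
          rw [e]
          nlinarith [mul_le_mul hδ1.le this (by positivity) zero_le_one]
      · intro x hx
        refine (hball x hx).1.trans ?_
        gcongr
        exact le_div_self hε0.le hσ hσ1
    have hgrid : ∑ i, excessLoss q₀ t (net θ') (ω i) - ∑ i, excessLoss q₀ t (net θ) (ω i)
        ≤ T / 2 := by
      rw [sum_excessLoss_sub]
      have hterm : ∀ i, ‖net θ' (noised t (ω i)) - target t (ω i).2‖ ^ 2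
          - ‖net θ (noised t (ω i)) - target t (ω i).2‖ ^ 2 ≤ δs * ε ^ 2 / (128 * σ ^ 2) := by
        intro i
        have hx := norm_noised_le ht (htypω i)
        rw [← hB, ← hℓ, ← hR] at hx
        have hw := norm_target_le ht (htypω i)
        rw [← hB, ← hℓ] at hw
        have hw' : ‖target t (ω i).2‖ ≤ R / σ := by
          refine hw.trans ?_
          gcongr
          rw [hR]
          have : 0 ≤ max m₂ 1 / Real.sqrt κ :=
            div_nonneg (le_max_of_le_right zero_le_one) (Real.sqrt_nonneg _)
          linarith
        have := (hball _ hx).2 hσ hσ1 hw'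
        rw [abs_sub_comm] at this
        exact (le_abs_self _).trans this
      refine (Finset.sum_le_sum fun i _ => hterm i).trans (le_of_eq ?_)
      rw [Finset.sum_const, Finset.card_univ, Fintype.card_fin, nsmul_eq_mul, hT]
      field_simp
      norm_num
    have hle := sum_excessLoss_le_of_isEmpiricalMinimizer (q₀ := q₀) hm hmin hθs
    exact h4 (Set.mem_biUnion hθ'bad ⟨htypx, by linarith⟩)
  have hEatyp : Measure.pi (fun _ : Fin m => sampleLaw q₀ t) Eatyp ≤ ENNReal.ofReal (δ / 5) := by
    refine (measure_pi_exists_le measurableSet_typicalSamples.compl).trans ?_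
    refine (mul_le_mul_right
      (measure_compl_typicalSamples_le ht hκ0 hκ1 hint hm₂ hm₂0) _).trans (le_of_eq ?_)
    rw [← ENNReal.ofReal_natCast, ← ENNReal.ofReal_mul (by positivity), hκ]
    congr 1
    field_simp
    norm_num
  have hEerr : Measure.pi (fun _ : Fin m => sampleLaw q₀ t) Eerr ≤ ENNReal.ofReal (δ / 5) := by
    have hmeas : Measurable fun x => ‖net θs x - score q₀ t x‖ ^ 2 :=
      ((continuous_net θs).measurable.sub measurable_score).norm.pow_const 2
    refine (measure_pi_sum_ge_le (hmeas.comp measurable_noised) (fun p => by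
      exact sq_nonneg _) hupos).trans ?_
    have e : ∫⁻ p, ENNReal.ofReal (sqErr p) ∂(sampleLaw q₀ t)
        = ∫⁻ x, ENNReal.ofReal (‖net θs x - score q₀ t x‖ ^ 2) ∂(smoothed q₀ t) := by
      rw [smoothed, lintegral_map hmeas.ennreal_ofReal measurable_noised]
    have e2 : (m : ENNReal) * ∫⁻ p, ENNReal.ofReal (sqErr p) ∂(sampleLaw q₀ t)
        ≤ ENNReal.ofReal (m * (δs * δ * ε ^ 2 / (2000 * σ ^ 2))) := by
      rw [e, ENNReal.ofReal_mul (by positivity), ENNReal.ofReal_natCast]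
      gcongr
    refine (ENNReal.div_le_div_right e2 _).trans ?_
    rw [← ENNReal.ofReal_div_of_pos hupos]
    refine ENNReal.ofReal_le_ofReal (le_of_eq ?_)
    rw [hu]
    field_simp
    norm_num
  have hEstar : Measure.pi (fun _ : Fin m => sampleLaw q₀ t) Estar ≤ ENNReal.ofReal (δ / 5) := by
    refine (measure_sum_excessLoss_ge_le ht hB2 ha (continuous_net θs).measurable _).trans
      (ENNReal.ofReal_le_ofReal (le_of_eq ?_))
    rw [Real.exp_neg, Real.exp_log (by positivity), inv_div]
  have hEgrid : Measure.pi (fun _ : Fin m => sampleLaw q₀ t) (⋃ θ ∈ N', Egrid θ)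
      ≤ ENNReal.ofReal (δ / 5) := by
    have hone : ∀ θ ∈ N', Measure.pi (fun _ : Fin m => sampleLaw q₀ t) (Egrid θ)
        ≤ ENNReal.ofReal (Real.exp (-(m * δs * ε ^ 2 / (8192 * ℓ)))) := by
      intro θ hθ
      have hr : a * (ε / σ / 2) ^ 2 / 2 = ε ^ 2 / (1024 * ℓ) := by
        rw [ha_def]; field_simp; norm_num
      refine (measure_sum_excessLoss_le_le ht hB2 ha ha0.le (by positivity) ?_
        (continuous_net θ).measurable (Finset.mem_filter.1 hθ).2).trans (le_of_eq ?_)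
      · rw [hr, div_le_one (by positivity)]
        have : ε ^ 2 ≤ 1 := pow_le_one₀ hε0.le hε1
        linarith
      · rw [hr, ha_def, hT]
        congr 2
        field_simp
        norm_num
    refine (measure_biUnion_finset_le _ _).trans ((Finset.sum_le_sum hone).trans ?_)
    rw [Finset.sum_const, nsmul_eq_mul, ← ENNReal.ofReal_natCast,
      ← ENNReal.ofReal_mul (by positivity)]
    refine ENNReal.ofReal_le_ofReal (le_trans ?_ hcard)
    gcongr
    refine le_trans ?_ hN
    exact_mod_cast Finset.card_filter_le _ _
  refine (measure_mono hcover).trans ((measure_union_le _ _).trans ?_)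
  refine (add_le_add ((measure_union_le _ _).trans (add_le_add ((measure_union_le _ _).trans
    (add_le_add hEatyp hEerr)) hEstar)) hEgrid).trans ?_
  rw [← ENNReal.ofReal_add (by positivity) (by positivity),
    ← ENNReal.ofReal_add (by positivity) (by positivity),
    ← ENNReal.ofReal_add (by positivity) (by positivity)]
  exact ENNReal.ofReal_le_ofReal (by linarith)

end

/-! ### Sample complexity arithmetic -/

/-- A sample size above `K X log²(2 + X)` also dominates `X log² m`: otherwise
`log m ≤ 4 m^{1/4}` first gives a polynomial bound on `m` in terms of `X`, hence
`log m = O(log(2 + X))`, which contradicts the assumption. -/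
theorem mul_log_sq_le_of_lt {X m : ℝ} (hX : 1 ≤ X)
    (h : 1296000000 * X * Real.log (2 + X) ^ 2 < m) :
    3 ≤ m ∧ 1000000 * X * Real.log m ^ 2 ≤ m := by
  have hL : 1 ≤ Real.log (2 + X) := by
    rw [Real.le_log_iff_exp_le (by linarith)]
    linarith [Real.exp_one_lt_d9]
  have hL2 : 1 ≤ Real.log (2 + X) ^ 2 := one_le_pow₀ hL
  have hm3 : 3 ≤ m := by nlinarith
  refine ⟨hm3, ?_⟩
  by_contra! hcon
  have hm0 : 0 < m := by linarith
  have hlm0 : 0 ≤ Real.log m := Real.log_nonneg (by linarith)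
  have h1 : Real.log m ≤ 4 * Real.sqrt (Real.sqrt m) := by
    have e : Real.log (Real.sqrt (Real.sqrt m)) = Real.log m / 4 := by
      rw [Real.log_sqrt (Real.sqrt_nonneg m), Real.log_sqrt hm0.le]; ring
    have := Real.log_le_sub_one_of_pos (Real.sqrt_pos.2 (Real.sqrt_pos.2 hm0))
    rw [e] at this
    linarith
  have h2 : Real.log m ^ 2 ≤ 16 * Real.sqrt m := by
    calc Real.log m ^ 2 ≤ (4 * Real.sqrt (Real.sqrt m)) ^ 2 := pow_le_pow_left₀ hlm0 h1 2
      _ = 16 * Real.sqrt m := by rw [mul_pow, Real.sq_sqrt (Real.sqrt_nonneg m)]; norm_num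
  have h3 : Real.sqrt m < 16000000 * X := by
    have h4 : Real.sqrt m * Real.sqrt m < 16000000 * X * Real.sqrt m := by
      rw [Real.mul_self_sqrt hm0.le]
      nlinarith
    exact lt_of_mul_lt_mul_right h4 (Real.sqrt_nonneg m)
  have h5 : Real.log m ≤ 36 * Real.log (2 + X) := by
    have e : Real.log (Real.sqrt m) = Real.log m / 2 := Real.log_sqrt hm0.le
    have h6 := Real.log_le_log (Real.sqrt_pos.2 hm0) h3.le
    rw [e, Real.log_mul (by norm_num) (by linarith)] at h6
    have h7 : Real.log 16000000 ≤ 17 := by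
      have h8 : Real.log 16000000 ≤ Real.log ((2 : ℝ) ^ 24) :=
        Real.log_le_log (by norm_num) (by norm_num)
      rw [Real.log_pow] at h8
      push_cast at h8
      linarith [Real.log_two_lt_d9]
    have h9 : Real.log X ≤ Real.log (2 + X) := Real.log_le_log (by linarith) (by linarith)
    linarith
  have h10 : Real.log m ^ 2 ≤ 1296 * Real.log (2 + X) ^ 2 := by
    calc Real.log m ^ 2 ≤ (36 * Real.log (2 + X)) ^ 2 := pow_le_pow_left₀ hlm0 h5 2
      _ = _ := by ring
  nlinarith

theorem log_five_le : Real.log 5 ≤ 3 := by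
  have h : Real.log 5 ≤ Real.log ((2 : ℝ) ^ 3) := Real.log_le_log (by norm_num) (by norm_num)
  rw [Real.log_pow] at h
  push_cast at h
  linarith [Real.log_two_lt_d9]

theorem log_fifteen_le : Real.log 15 ≤ 3 := by
  have h : Real.log 15 ≤ Real.log ((2 : ℝ) ^ 4) := Real.log_le_log (by norm_num) (by norm_num)
  rw [Real.log_pow] at h
  push_cast at h
  linarith [Real.log_two_lt_d9]

/-- A bound on the metric entropy of the grid per parameter. -/
theorem log_grid_size_le {D : ℕ} {M Θ δ m : ℝ} (hD : 0 < D) (hM : 1 ≤ M) (hΘ : 1 < Θ)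
    (hδ0 : 0 < δ) (hδ1 : δ < 1) (hm0 : 0 < m) (hlm1 : 1 ≤ Real.log m) :
    Real.log (2 ^ 17 * (3 * Θ) ^ (4 * D) * (M ^ 2 * (m * (m * (1 / δ)))))
      ≤ 20 * (D * (1 + Real.log (M * Θ / δ)) * Real.log m) := by
  have hD1 : (1 : ℝ) ≤ D := by exact_mod_cast hD
  set lm := Real.log m with hlm
  set lδ := Real.log (1 / δ) with hlδ
  have hlδ0 : 0 ≤ lδ := Real.log_nonneg (by rw [le_div_iff₀ hδ0]; linarith)
  have hlM0 : 0 ≤ Real.log M := Real.log_nonneg hM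
  have hlΘ0 : 0 ≤ Real.log Θ := Real.log_nonneg hΘ.le
  set Λ := Real.log (M * Θ / δ) with hΛ
  have hΛeq : Λ = Real.log M + Real.log Θ + lδ := by
    rw [hΛ, hlδ, div_eq_mul_one_div, Real.log_mul (by positivity) (by positivity),
      Real.log_mul (by positivity) (by positivity)]
  have hΛ0 : 0 ≤ Λ := by linarith
  rw [Real.log_mul (by positivity) (by positivity), Real.log_mul (by positivity) (by positivity),
    Real.log_mul (by positivity) (by positivity), Real.log_mul (by positivity) (by positivity),
    Real.log_mul (by positivity) (by positivity), Real.log_pow, Real.log_pow, Real.log_pow,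
    Real.log_mul (by norm_num) (by positivity)]
  push_cast
  have hlog3 : Real.log 3 ≤ 1.4 := by
    have h : Real.log 3 ≤ Real.log ((2 : ℝ) ^ 2) :=
      Real.log_le_log (by norm_num) (by norm_num)
    rw [Real.log_pow] at h
    push_cast at h
    linarith [Real.log_two_lt_d9]
  have h1 : 17 * Real.log 2 ≤ 12 * D := by linarith [Real.log_two_lt_d9]
  have h2 : 4 * (D : ℝ) * (Real.log 3 + Real.log Θ) ≤ 5.6 * D + 4 * (D * Real.log Θ) := by
    nlinarith
  have h3 : Real.log M ≤ D * Real.log M := le_mul_of_one_le_left hlM0 hD1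
  have h4 : lδ ≤ D * lδ := le_mul_of_one_le_left hlδ0 hD1
  have h4' : 0 ≤ D * lδ := by positivity
  have h3' : 0 ≤ D * Real.log M := by positivity
  have h5 : lm ≤ D * lm := le_mul_of_one_le_left (by linarith) hD1
  have h6 : D * Λ = D * Real.log M + D * Real.log Θ + D * lδ := by rw [hΛeq]; ring
  have h7 : (D : ℝ) ≤ D * lm := le_mul_of_one_le_right (by linarith) hlm1
  have h8 : D * Λ ≤ D * Λ * lm := le_mul_of_one_le_right (by positivity) hlm1
  have h9 : 20 * (D * (1 + Λ) * lm) = 20 * (D * lm) + 20 * (D * Λ * lm) := by ring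
  have h10 : 0 ≤ D * Λ := by positivity
  have h11 : 0 ≤ D * Real.log Θ := by positivity
  rw [h9, ← hlm, ← hlδ]
  linarith

/-- The number of grid points per parameter is polynomial in the sample size. -/
theorem grid_size_le {P D : ℕ} {M Θ ε δs δ m κ ℓ R η : ℝ} (hD : 0 < D) (hP : 0 < P) (hM : 1 ≤ M)
    (hΘ : 1 < Θ) (hε0 : 0 < ε) (hδs0 : 0 < δs) (hδ0 : 0 < δ) (hδ1 : δ < 1) (hm1 : 1 ≤ m)
    (hPm : P ≤ m * δs * ε ^ 2) (hκ : κ = δ / (15 * m)) (hℓ16 : ℓ ≤ 16 * (m / δ))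
    (hR : R = M / Real.sqrt κ + 2 * Real.sqrt ℓ)
    (hη : η * (768 * (3 * Θ) ^ (2 * D + 1) * (R + 1) ^ 2) = δs * ε ^ 2) :
    0 < η ∧
      3 * Θ * P / η ≤ 2 ^ 17 * (3 * Θ) ^ (4 * D) * (M ^ 2 * (m * (m * (1 / δ)))) := by
  have hm0 : 0 < m := by linarith
  have hP0 : (0 : ℝ) < P := by exact_mod_cast hP
  have hκ0 : 0 < κ := by rw [hκ]; positivity
  set s := Real.sqrt (m / δ) with hs
  have hmδ1 : 1 ≤ m / δ := by rw [le_div_iff₀ hδ0]; linarith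
  have hs1 : 1 ≤ s := Real.one_le_sqrt.2 hmδ1
  have hMk : M / Real.sqrt κ ≤ 4 * M * s := by
    have e : 1 / κ = 15 * (m / δ) := by rw [hκ]; field_simp
    have e2 : M / Real.sqrt κ = M * (Real.sqrt 15 * s) := by
      rw [hs, ← Real.sqrt_mul (by norm_num), ← e, Real.sqrt_div zero_le_one, Real.sqrt_one]
      ring
    have e3 : Real.sqrt 15 ≤ 4 := Real.sqrt_le_iff.2 ⟨by norm_num, by norm_num⟩
    rw [e2]
    calc M * (Real.sqrt 15 * s) ≤ M * (4 * s) := by gcongr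
      _ = _ := by ring
  have hℓs : Real.sqrt ℓ ≤ 4 * s := by
    calc Real.sqrt ℓ ≤ Real.sqrt (16 * (m / δ)) := Real.sqrt_le_sqrt hℓ16
      _ = 4 * s := by
        rw [Real.sqrt_mul (by norm_num), show (16 : ℝ) = 4 ^ 2 by norm_num,
          Real.sqrt_sq (by norm_num)]
  have hMs : s ≤ M * s := le_mul_of_one_le_left (by linarith) hM
  have hR1 : R + 1 ≤ 13 * (M * s) := by
    rw [hR]; linarith
  have hR0 : 0 ≤ R := by rw [hR]; positivity
  have hR2 : (R + 1) ^ 2 ≤ 169 * (M ^ 2 * (m / δ)) := by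
    calc (R + 1) ^ 2 ≤ (13 * (M * s)) ^ 2 := pow_le_pow_left₀ (by linarith) hR1 2
      _ = 169 * (M ^ 2 * s ^ 2) := by ring
      _ = _ := by rw [hs, Real.sq_sqrt (by positivity)]
  have hη0 : 0 < η := by
    refine pos_of_mul_pos_left (b := 768 * (3 * Θ) ^ (2 * D + 1) * (R + 1) ^ 2) ?_ (by positivity)
    rw [hη]; positivity
  refine ⟨hη0, ?_⟩
  have e : 3 * Θ * P / η = 768 * (3 * Θ) ^ (2 * D + 2) * (R + 1) ^ 2 * (P / (δs * ε ^ 2)) := by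
    rw [← hη]
    field_simp
    ring
  have hP' : (P : ℝ) / (δs * ε ^ 2) ≤ m := by
    rw [div_le_iff₀ (by positivity)]; linarith
  have hpow : (3 * Θ) ^ (2 * D + 2) ≤ (3 * Θ) ^ (4 * D) :=
    pow_le_pow_right₀ (by linarith) (by omega)
  rw [e]
  calc _ ≤ 768 * (3 * Θ) ^ (4 * D) * (169 * (M ^ 2 * (m / δ))) * m := by gcongr
    _ = 129792 * ((3 * Θ) ^ (4 * D) * (M ^ 2 * (m * (m * (1 / δ))))) := by ring
    _ ≤ 2 ^ 17 * ((3 * Θ) ^ (4 * D) * (M ^ 2 * (m * (m * (1 / δ))))) := by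
      gcongr; norm_num
    _ = _ := by ring

/-- The three numerical requirements of the probabilistic argument, in terms of the grid resolution
`η`, hold as soon as `m` dominates `X log² m`. -/
theorem numerical_requirements {d P D : ℕ} {M Θ ε δs δ m κ ℓ R η : ℝ} (hd : 0 < d) (hP : 0 < P)
    (hD : 0 < D) (hM : 1 ≤ M) (hΘ : 1 < Θ) (hε0 : 0 < ε) (hε1 : ε ≤ 1) (hδs0 : 0 < δs)
    (hδs1 : δs < 1) (hδ0 : 0 < δ) (hδ1 : δ < 1) (hm3 : 3 ≤ m)
    (hm : 1000000 * (((d + Real.log (1 / δ)) * P * D) / (ε ^ 2 * δs) *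
      (1 + Real.log (M * Θ / δ))) * Real.log m ^ 2 ≤ m)
    (hκ : κ = δ / (15 * m)) (hℓ : ℓ = Real.log (2 ^ d / κ))
    (hR : R = M / Real.sqrt κ + 2 * Real.sqrt ℓ)
    (hη : η * (768 * (3 * Θ) ^ (2 * D + 1) * (R + 1) ^ 2) = δs * ε ^ 2) :
    1 ≤ m * δs ∧
      (3 * Θ * P / η) ^ P * Real.exp (-(m * δs * ε ^ 2 / (8192 * ℓ))) ≤ δ / 5 ∧
      32768 * ℓ * Real.log (5 / δ) ≤ m * δs * ε ^ 2 := by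
  have hd1 : (1 : ℝ) ≤ d := by exact_mod_cast hd
  have hP1 : (1 : ℝ) ≤ P := by exact_mod_cast hP
  have hD1 : (1 : ℝ) ≤ D := by exact_mod_cast hD
  have hm0 : 0 < m := by linarith
  set lm := Real.log m with hlm
  have hlm1 : 1 ≤ lm := by
    rw [hlm, Real.le_log_iff_exp_le hm0]
    linarith [Real.exp_one_lt_d9]
  set lδ := Real.log (1 / δ) with hlδ
  have hlδ0 : 0 ≤ lδ := Real.log_nonneg (by rw [le_div_iff₀ hδ0]; linarith)
  have hlM0 : 0 ≤ Real.log M := Real.log_nonneg hM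
  have hlΘ0 : 0 ≤ Real.log Θ := Real.log_nonneg hΘ.le
  set Λ := Real.log (M * Θ / δ) with hΛ
  have hΛeq : Λ = Real.log M + Real.log Θ + lδ := by
    rw [hΛ, hlδ, div_eq_mul_one_div, Real.log_mul (by positivity) (by positivity),
      Real.log_mul (by positivity) (by positivity)]
  have hΛ0 : 0 ≤ Λ := by linarith
  set b := (d : ℝ) + lδ with hb
  have hb1 : 1 ≤ b := by linarith
  set S := m * δs * ε ^ 2 with hS
  have hS0 : 0 < S := by positivity
  have hmain : 1000000 * (b * P * D * (1 + Λ) * lm ^ 2) ≤ S := by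
    have e : 1000000 * ((b * P * D) / (ε ^ 2 * δs) * (1 + Λ)) * lm ^ 2
        = 1000000 * (b * P * D * (1 + Λ) * lm ^ 2) / (ε ^ 2 * δs) := by ring
    rw [e, div_le_iff₀ (by positivity)] at hm
    linarith
  -- `m` dominates `d`, `1 / δs` and `P / (δs ε²)`
  have hPm : P ≤ S := by
    have h1 : (P : ℝ) ≤ b * P * D * (1 + Λ) * lm ^ 2 := by
      have h2 : 1 ≤ b * D * (1 + Λ) * lm ^ 2 :=
        one_le_mul_of_one_le_of_one_le (one_le_mul_of_one_le_of_one_le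
          (one_le_mul_of_one_le_of_one_le hb1 hD1) (by linarith)) (one_le_pow₀ hlm1)
      calc (P : ℝ) = P * 1 := by ring
        _ ≤ P * (b * D * (1 + Λ) * lm ^ 2) := by gcongr
        _ = _ := by ring
    linarith
  have hdm : d ≤ m := by
    have h1 : b ≤ b * P * D * (1 + Λ) * lm ^ 2 := by
      have h2 : 1 ≤ P * D * (1 + Λ) * lm ^ 2 :=
        one_le_mul_of_one_le_of_one_le (one_le_mul_of_one_le_of_one_le
          (one_le_mul_of_one_le_of_one_le hP1 hD1) (by linarith)) (one_le_pow₀ hlm1)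
      calc b = b * 1 := by ring
        _ ≤ b * (P * D * (1 + Λ) * lm ^ 2) := by gcongr
        _ = _ := by ring
    have h3 : S ≤ m := by
      have : δs * ε ^ 2 ≤ 1 := mul_le_one₀ hδs1.le (by positivity) (pow_le_one₀ hε0.le hε1)
      calc S = m * (δs * ε ^ 2) := by ring
        _ ≤ m * 1 := by gcongr
        _ = m := mul_one m
    linarith
  have hmδ : 1 ≤ m * δs := by
    have : S ≤ m * δs := mul_le_of_le_one_right (by positivity) (pow_le_one₀ hε0.le hε1)
    linarith
  have hκ0 : 0 < κ := by rw [hκ]; positivity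
  have hinv : 2 ^ d / κ = 2 ^ d * (15 * (m * (1 / δ))) := by
    rw [hκ]; field_simp
  have hℓeq : ℓ = d * Real.log 2 + (Real.log 15 + (lm + lδ)) := by
    rw [hℓ, hinv, Real.log_mul (by positivity) (by positivity), Real.log_pow,
      Real.log_mul (by norm_num) (by positivity), Real.log_mul hm0.ne' (by positivity)]
  have hlog2 : (d : ℝ) * Real.log 2 ≤ d :=
    mul_le_of_le_one_right (by linarith) (by linarith [Real.log_two_lt_d9])
  have hblm : b ≤ b * lm := le_mul_of_one_le_right (by linarith) hlm1
  have hlmb : lm ≤ b * lm := le_mul_of_one_le_left (by linarith) hb1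
  have hℓ0 : 0 < ℓ := by
    rw [hℓeq]
    have : 0 ≤ d * Real.log 2 := by positivity
    have : 0 ≤ Real.log 15 := Real.log_nonneg (by norm_num)
    linarith
  have hℓle : ℓ ≤ 5 * (b * lm) := by
    rw [hℓeq]
    linarith [log_fifteen_le]
  have hlog5 : Real.log (5 / δ) ≤ 3 * (1 + Λ) := by
    rw [div_eq_mul_one_div, Real.log_mul (by norm_num) (by positivity)]
    linarith [log_five_le]
  have hlog5' : 0 ≤ Real.log (5 / δ) := Real.log_nonneg (by rw [le_div_iff₀ hδ0]; linarith)
  set W := P * D * (1 + Λ) * lm with hW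
  have hPD : (1 : ℝ) ≤ P * D := one_le_mul_of_one_le_of_one_le hP1 hD1
  have hW1 : 1 + Λ ≤ W := by
    calc 1 + Λ = 1 * (1 + Λ) * 1 := by ring
      _ ≤ P * D * (1 + Λ) * lm := by gcongr
  have hmain' : 1000000 * (b * lm * W) ≤ S := by
    refine le_trans (le_of_eq ?_) hmain
    rw [hW]; ring
  have hblm0 : 0 ≤ b * lm := by linarith
  have hWpos : 0 ≤ W := by linarith
  have hℓW : ∀ c : ℝ, 0 ≤ c → ℓ * (c * W) ≤ 5 * c * (b * lm * W) := by
    intro c hc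
    calc ℓ * (c * W) ≤ 5 * (b * lm) * (c * W) := by gcongr
      _ = _ := by ring
  have hblmW : 0 ≤ b * lm * W := by positivity
  refine ⟨hmδ, ?_, ?_⟩
  · -- the entropy of the grid
    have hℓ16 : ℓ ≤ 16 * (m / δ) := by
      have h2 : Real.log 15 + (lm + lδ) ≤ 15 * (m * (1 / δ)) := by
        rw [hlm, hlδ, ← Real.log_mul hm0.ne' (by positivity),
          ← Real.log_mul (by norm_num) (by positivity)]
        have := Real.log_le_sub_one_of_pos (show 0 < 15 * (m * (1 / δ)) by positivity)
        linarith
      have h3 : m ≤ m / δ := le_div_self hm0.le hδ0 hδ1.le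
      have h4 : m * (1 / δ) = m / δ := by ring
      rw [hℓeq]
      rw [h4] at h2
      linarith
    obtain ⟨hη0, hval⟩ := grid_size_le hD hP hM hΘ hε0 hδs0 hδ0 hδ1 (by linarith) hPm hκ hℓ16 hR hη
    have hlogval : Real.log (3 * Θ * P / η) ≤ 20 * (D * (1 + Λ) * lm) := by
      refine (Real.log_le_log (by positivity) hval).trans ?_
      exact log_grid_size_le hD hM hΘ hδ0 hδ1 hm0 hlm1
    have hpos : 0 < 3 * Θ * P / η := by positivity
    have hsum : P * Real.log (3 * Θ * P / η) + Real.log (5 / δ) ≤ S / (8192 * ℓ) := by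
      rw [le_div_iff₀ (by positivity)]
      have h1 : P * Real.log (3 * Θ * P / η) ≤ 20 * W := by
        calc P * Real.log (3 * Θ * P / η) ≤ P * (20 * (D * (1 + Λ) * lm)) := by gcongr
          _ = 20 * W := by rw [hW]; ring
      have h2 : Real.log (5 / δ) ≤ 3 * W := by linarith
      have h3 := hℓW 23 (by norm_num)
      calc (P * Real.log (3 * Θ * P / η) + Real.log (5 / δ)) * (8192 * ℓ)
          ≤ (20 * W + 3 * W) * (8192 * ℓ) := by gcongr
        _ = 8192 * (ℓ * (23 * W)) := by ring
        _ ≤ S := by linarith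
    have hexp : (3 * Θ * P / η) ^ P = Real.exp (P * Real.log (3 * Θ * P / η)) := by
      rw [Real.exp_nat_mul, Real.exp_log hpos]
    have h5 : δ / 5 = Real.exp (-Real.log (5 / δ)) := by
      rw [Real.exp_neg, Real.exp_log (by positivity), inv_div]
    rw [hexp, ← Real.exp_add, h5]
    refine Real.exp_le_exp.2 ?_
    linarith
  · have h1 : Real.log (5 / δ) ≤ 3 * W := by linarith
    have h2 := hℓW 3 (by norm_num)
    calc 32768 * ℓ * Real.log (5 / δ) ≤ 32768 * ℓ * (3 * W) := by gcongr
      _ = 32768 * (ℓ * (3 * W)) := by ring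
      _ ≤ S := by linarith

theorem one_le_sampleBound {d P D : ℕ} {m₂ Θ ε δs δ : ℝ} (hd : 0 < d) (hP : 0 < P) (hD : 0 < D)
    (hΘ : 1 < Θ) (hε0 : 0 < ε) (hε1 : ε ≤ 1) (hδs0 : 0 < δs) (hδs1 : δs < 1) (hδ0 : 0 < δ)
    (hδ1 : δ < 1) : 1 ≤ sampleBound d P D m₂ Θ ε δs δ := by
  have hd1 : (1 : ℝ) ≤ d := by exact_mod_cast hd
  have hP1 : (1 : ℝ) ≤ P := by exact_mod_cast hP
  have hD1 : (1 : ℝ) ≤ D := by exact_mod_cast hD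
  have h1 : 0 ≤ Real.log (1 / δ) := Real.log_nonneg (by rw [le_div_iff₀ hδ0]; linarith)
  have hM : 1 ≤ max m₂ 1 * Θ := one_le_mul_of_one_le_of_one_le (le_max_right _ _) hΘ.le
  have h2 : 0 ≤ Real.log (max m₂ 1 * Θ / δ) :=
    Real.log_nonneg (by rw [le_div_iff₀ hδ0]; linarith)
  unfold sampleBound
  refine one_le_mul_of_one_le_of_one_le ?_ (by linarith)
  rw [le_div_iff₀ (by positivity), one_mul]
  have h3 : ε ^ 2 * δs ≤ 1 := mul_le_one₀ (pow_le_one₀ hε0.le hε1) hδs0.le hδs1.le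
  exact h3.trans (one_le_mul_of_one_le_of_one_le
    (one_le_mul_of_one_le_of_one_le (by linarith) hP1) hD1)

end ScoreLearning

end

theorem mainTheorem3 :
    ∃ (C K : ℝ) (k : ℕ), 0 < C ∧ 0 < K ∧
      ∀ (d : ℕ) (hs : List ℕ) (biased : Bool)
        (q₀ : Measure (EuclideanSpace ℝ (Fin d))) (m₂ t Θ ε δscore δtrain : ℝ) (m : ℕ),
        0 < d → (∀ h ∈ hs, 0 < h) →
        IsProbabilityMeasure q₀ →
        0 ≤ m₂ → Integrable (fun y => ‖y‖ ^ 2) q₀ → ∫ y, ‖y‖ ^ 2 ∂q₀ = m₂ ^ 2 →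
        0 < t → 1 < Θ → 0 < ε → ε ≤ 1 →
        0 < δscore → δscore < 1 → 0 < δtrain → δtrain < 1 →
        (∃ θstar : ScoreLearning.Params biased d hs d, ‖θstar‖ ≤ Θ ∧
          ∫⁻ x, ENNReal.ofReal (‖ScoreLearning.net θstar x - ScoreLearning.score q₀ t x‖ ^ 2)
              ∂(ScoreLearning.smoothed q₀ t)
            ≤ ENNReal.ofReal
                (δscore * δtrain * ε ^ 2 / (C * ScoreLearning.noiseLevel t ^ 2))) →
        K * ScoreLearning.sampleBound d (ScoreLearning.numParams biased d hs d)
              (ScoreLearning.depth hs) m₂ Θ ε δscore δtrain *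
            Real.log (2 + ScoreLearning.sampleBound d (ScoreLearning.numParams biased d hs d)
              (ScoreLearning.depth hs) m₂ Θ ε δscore δtrain) ^ k < (m : ℝ) →
        Measure.pi (fun _ : Fin m => ScoreLearning.sampleLaw q₀ t)
            {ω | ∃ θhat : ScoreLearning.Params biased d hs d,
              ScoreLearning.IsEmpiricalMinimizer t Θ ω θhat ∧
              ¬ ScoreLearning.QuantileErrorLE (ScoreLearning.smoothed q₀ t) δscore
                (ScoreLearning.net θhat) (ScoreLearning.score q₀ t)
                (ε / ScoreLearning.noiseLevel t)}
          ≤ ENNReal.ofReal δtrain := by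
  refine ⟨2000, 1296000000, 2, by norm_num, by norm_num, ?_⟩
  intro d hs biased q₀ m₂ t Θ ε δs δ m hd hhs hq hm₂0 hint hm₂ ht hΘ hε0 hε1 hδs0 hδs1 hδ0 hδ1
    ⟨θs, hθs, herr⟩ hm
  have hP : 0 < ScoreLearning.numParams biased d hs d :=
    hd.trans_le (ScoreLearning.le_numParams hd hhs)
  have hD : 0 < ScoreLearning.depth hs := Nat.succ_pos _
  obtain ⟨hm3, hmX⟩ := ScoreLearning.mul_log_sq_le_of_lt
    (ScoreLearning.one_le_sampleBound hd hP hD hΘ hε0 hε1 hδs0 hδs1 hδ0 hδ1) hm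
  have hm0 : 0 < m := by
    have : (0 : ℝ) < m := by linarith
    exact_mod_cast this
  set R : ℝ := max m₂ 1 / Real.sqrt (δ / (15 * m))
    + 2 * Real.sqrt (Real.log (2 ^ d / (δ / (15 * m)))) with hR
  have hη : δs * ε ^ 2 / (768 * (3 * Θ) ^ (2 * ScoreLearning.depth hs + 1) * (R + 1) ^ 2) *
      (768 * (3 * Θ) ^ (2 * ScoreLearning.depth hs + 1) * (R + 1) ^ 2) = δs * ε ^ 2 := by
    have hR0 : 0 ≤ R := by
      have : 0 < max m₂ 1 := lt_max_of_lt_right one_pos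
      rw [hR]; positivity
    have hden : 0 < 768 * (3 * Θ) ^ (2 * ScoreLearning.depth hs + 1) * (R + 1) ^ 2 := by
      positivity
    exact div_mul_cancel₀ _ hden.ne'
  obtain ⟨h1, h2, h3⟩ := ScoreLearning.numerical_requirements hd hP hD (le_max_right m₂ 1) hΘ hε0
    hε1 hδs0 hδs1 hδ0 hδ1 hm3 hmX rfl rfl hR hη
  exact ScoreLearning.measure_bad_minimizer_le hd hm0 ht hm₂0 hint hm₂ hΘ hε0 hε1 hδs0 hδs1 hδ0 hδ1
    rfl rfl hR hη h1 hP h2 h3 hθs herr
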